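/- Let $\mathcal A$ be a Grothendieck abelian category (a cocomplete abelian category with exact directed colimits and a set of generators), and let $C(\mathcal A)$ be the abelian category of unbounded cochain complexes in $\mathcal A$, $K(\mathcal A)$ its homotopy category and $D(\mathcal A)$ its derived category. Let $C(\mathcal A)_{ac}$ be the class of acyclic complexes. A complex $J$ is homotopy injective if $\mathrm{Hom}_{K(\mathcal A)}(X,J)=0$ for every acyclic complex $X$; let $C(\mathcal A_{inj})_{hin}$ be the class of homotopy injective complexes all of whose terms are injective objects of $\mathcal A$, and let $K(\mathcal A_{inj})_{hin}\subset K(\mathcal A)$ be the corresponding full subcategory of the homotopy category. (1) The pair $(\mathsf L,\mathsf R)=(C(\mathcal A)_{ac},\,C(\mathcal A_{inj})_{hin})$ is a hereditary complete cotorsion pair in $C(\mathcal A)$. That is: $\mathsf R$ is the class of all $Y$ with $\mathrm{Ext}^1(L,Y)=0$ for all $L\in\mathsf L$, and $\mathsf L$ is the class of all $X$ with $\mathrm{Ext}^1(X,R)=0$ for all $R\in\mathsf R$; every complex $E$ admits short exact sequences $0\to R'\to L\to E\to 0$ and $0\to E\to R\to L'\to 0$ with $L,L'\in\mathsf L$ and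 $R,R'\in\mathsf R$; $\mathsf L$ contains the kernels of epimorphisms between its objects, $\mathsf R$ contains the cokernels of monomorphisms between its objects, and $\mathrm{Ext}^n(L,R)=0$ for all $L\in\mathsf L$, $R\in\mathsf R$, $n\ge 1$. (2) There is a model structure on $C(\mathcal A)$ in which all objects are cofibrant, the weakly trivial objects (those $W$ with $0\to W$ a weak equivalence) are exactly the acyclic complexes, and the fibrant objects are exactly the complexes in $C(\mathcal A_{inj})_{hin}$. It is abelian: the cofibrations are the monomorphisms with cofibrant cokernel, and the fibrations are the epimorphisms with fibrant kernel. It is hereditary: the classes of cofibrant and of cofibrant weakly trivial objects contain the kernels of epimorphisms between their objects, and the classes of fibrant and of fibrant weakly trivial objects contain the cokernels of monomorphisms between their objects. It is cofibrantly generated: each of the classes of fibrations and of trivial fibrations is the class of all morphisms with the right lifting property with respect to some set of morphisms. (This is the injective derived model structure.) (3) $\mathcal A$ has enough homotopy injective complexes of injective objects: $K(\mathcal A_{inj})_{hin}$ is a triangulated subcategory of $K(\mathcal A)$, and the natural functor $K(\mathcal A_{inj})_{hin}\to D(\mathcal A)$ is a triangulated equivalence. -/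

import Mathlib

open CategoryTheory CategoryTheory.Limits CategoryTheory.Abelian HomotopicalAlgebra

universe w v u

namespace AbelianModel

section Cotorsion

variable {E : Type u} [Category.{v} E] [Abelian E]

/-- `L^{⊥₁}`: the objects `X` such that `Ext¹(Y, X) = 0` for every `Y` in `L`. -/
def rightExtPerp [HasExt.{w} E] (L : ObjectProperty E) : ObjectProperty E :=
  fun X => ∀ ⦃Y : E⦄, L Y → ∀ e : Ext.{w} Y X 1, e = 0

/-- `^{⊥₁}R`: the objects `Y` such that `Ext¹(Y, X) = 0` for every `X` in `R`. -/
def leftExtPerp [HasExt.{w} E] (R : ObjectProperty E) : ObjectProperty E :=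
  fun Y => ∀ ⦃X : E⦄, R X → ∀ e : Ext.{w} Y X 1, e = 0

/-- `(L, R)` is a cotorsion pair: `R = L^{⊥₁}` and `L = ^{⊥₁}R`. -/
structure IsCotorsionPair [HasExt.{w} E] (L R : ObjectProperty E) : Prop where
  right_eq : R = rightExtPerp.{w} L
  left_eq : L = leftExtPerp.{w} R

/-- Every object `X` admits a short exact sequence `0 → R' → L' → X → 0` with `R'` in `R`
and `L'` in `L`. -/
def AdmitsSpecialPrecovers (L R : ObjectProperty E) : Prop :=
  ∀ X : E, ∃ (R' L' : E) (i : R' ⟶ L') (p : L' ⟶ X) (zero : i ≫ p = 0),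
    R R' ∧ L L' ∧ (ShortComplex.mk i p zero).ShortExact

/-- Every object `X` admits a short exact sequence `0 → X → R' → L' → 0` with `R'` in `R`
and `L'` in `L`. -/
def AdmitsSpecialPreenvelopes (L R : ObjectProperty E) : Prop :=
  ∀ X : E, ∃ (R' L' : E) (i : X ⟶ R') (p : R' ⟶ L') (zero : i ≫ p = 0),
    R R' ∧ L L' ∧ (ShortComplex.mk i p zero).ShortExact

/-- A cotorsion pair is complete if it admits both kinds of approximation sequences. -/
structure IsCompleteCotorsionPair [HasExt.{w} E] (L R : ObjectProperty E) : Prop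
    extends IsCotorsionPair.{w} L R where
  precovers : AdmitsSpecialPrecovers L R
  preenvelopes : AdmitsSpecialPreenvelopes L R

/-- `P` contains the kernels of epimorphisms between its objects. -/
def ClosedUnderKernelsOfEpis (P : ObjectProperty E) : Prop :=
  ∀ ⦃X Y : E⦄ (f : X ⟶ Y) [Epi f], P X → P Y → P (kernel f)

/-- `P` contains the cokernels of monomorphisms between its objects. -/
def ClosedUnderCokernelsOfMonos (P : ObjectProperty E) : Prop :=
  ∀ ⦃X Y : E⦄ (f : X ⟶ Y) [Mono f], P X → P Y → P (cokernel f)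

/-- A complete cotorsion pair which is hereditary.  The three conditions are equivalent to each
other for a complete cotorsion pair; all of them are recorded. -/
structure IsHereditaryCompleteCotorsionPair [HasExt.{w} E] (L R : ObjectProperty E) : Prop
    extends IsCompleteCotorsionPair.{w} L R where
  left_kernels : ClosedUnderKernelsOfEpis L
  right_cokernels : ClosedUnderCokernelsOfMonos R
  ext_eq_zero : ∀ ⦃X Y : E⦄, L X → R Y → ∀ n : ℕ, 1 ≤ n → ∀ e : Ext.{w} X Y n, e = 0

/-- The monomorphisms whose cokernel belongs to `L`. -/
def monoWithCokernelIn (L : ObjectProperty E) : MorphismProperty E :=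
  fun _ _ f => Mono f ∧ L (cokernel f)

/-- The epimorphisms whose kernel belongs to `R`. -/
def epiWithKernelIn (R : ObjectProperty E) : MorphismProperty E :=
  fun _ _ f => Epi f ∧ R (kernel f)

end Cotorsion

section ModelStructure

variable (E : Type u) [Category.{v} E]

/-- The weak factorization system with right class `R` is cofibrantly generated: `R` is the class
of morphisms with the right lifting property against some (`w`-small) set of morphisms. -/
def IsGeneratedBySet {E : Type u} [Category.{v} E] (R : MorphismProperty E) : Prop :=
  ∃ S : MorphismProperty E, MorphismProperty.IsSmall.{w} S ∧ R = S.rlp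

/-- Both weak factorization systems (cofibrations, trivial fibrations) and
(trivial cofibrations, fibrations) of the model structure are cofibrantly generated. -/
structure IsCofibrantlyGenerated [ModelCategory E] : Prop where
  trivialFibrations : IsGeneratedBySet.{w} (trivialFibrations E)
  fibrations : IsGeneratedBySet.{w} (fibrations E)

variable [Abelian E]

/-- The cofibrant objects of a model structure. -/
def cofibrantObjects [ModelCategory E] : ObjectProperty E := fun X => IsCofibrant X

/-- The fibrant objects of a model structure. -/
def fibrantObjects [ModelCategory E] : ObjectProperty E := fun X => IsFibrant X

/-- The weakly trivial objects: those `X` for which `0 → X` is a weak equivalence. -/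
def weaklyTrivialObjects [ModelCategory E] : ObjectProperty E :=
  fun X => WeakEquivalence (initial.to X)

/-- A model structure on an abelian category is abelian if the cofibrations are the monomorphisms
with cofibrant cokernel and the fibrations are the epimorphisms with fibrant kernel. -/
structure IsAbelianModelStructure [ModelCategory E] : Prop where
  cofibrations_eq : cofibrations E = monoWithCokernelIn (cofibrantObjects E)
  fibrations_eq : fibrations E = epiWithKernelIn (fibrantObjects E)

/-- A hereditary abelian model structure.  The four closure conditions are equivalent to each
other for an abelian model structure; all of them are recorded. -/
structure IsHereditaryAbelianModelStructure [ModelCategory E] : Prop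
    extends IsAbelianModelStructure E where
  cofibrant_kernels : ClosedUnderKernelsOfEpis (cofibrantObjects E)
  triviallyCofibrant_kernels :
    ClosedUnderKernelsOfEpis (cofibrantObjects E ⊓ weaklyTrivialObjects E)
  fibrant_cokernels : ClosedUnderCokernelsOfMonos (fibrantObjects E)
  triviallyFibrant_cokernels :
    ClosedUnderCokernelsOfMonos (fibrantObjects E ⊓ weaklyTrivialObjects E)

end ModelStructure

section Complexes

variable (A : Type u) [Category.{v} A] [Abelian A]

/-- The class of acyclic complexes in `A`. -/
def acyclicComplexes : ObjectProperty (CochainComplex A ℤ) := fun X => X.Acyclic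

/-- The class of homotopy injective complexes of injective objects in `A`, as complexes. -/
def homotopyInjectiveComplexesOfInjectives : ObjectProperty (CochainComplex A ℤ) :=
  fun J => (∀ n : ℤ, Injective (J.X n)) ∧ J.IsKInjective

/-- The full subcategory of homotopy injective complexes of injective objects in the homotopy
category: all terms are injective, and every morphism in the homotopy category from an acyclic
complex vanishes. -/
def homotopyInjectiveOfInjectives : ObjectProperty (HomotopyCategory A (ComplexShape.up ℤ)) :=
  fun J => (∀ n : ℤ, Injective (J.as.X n)) ∧
    (HomotopyCategory.subcategoryAcyclic A).rightOrthogonal J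

/-- The functor from homotopy injective complexes of injectives, up to homotopy, to the derived
category, given by the inclusion into the homotopy category followed by localization. -/
noncomputable abbrev homotopyInjectiveToDerived [HasDerivedCategory.{w} A] :
    (homotopyInjectiveOfInjectives A).FullSubcategory ⥤ DerivedCategory A :=
  (homotopyInjectiveOfInjectives A).ι ⋙ DerivedCategory.Qh

/-- `A` has enough homotopy injective complexes of injective objects: these form a triangulated
subcategory of the homotopy category, and the functor from it to the derived category is a
triangulated equivalence. -/
def HasEnoughHomotopyInjectivesOfInjectives [HasDerivedCategory.{w} A] : Prop :=
  ∃ _ : (homotopyInjectiveOfInjectives A).IsTriangulated,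
    (homotopyInjectiveToDerived A).IsTriangulated ∧
      (homotopyInjectiveToDerived A).IsEquivalence

end Complexes

end AbelianModel

/-! Call monomorphic quasi-isomorphisms trivial cofibrations, and epimorphisms whose kernel is a
homotopy injective complex of injectives fibrations. Everything follows once these two classes form
a cofibrantly generated weak factorization system.

Lifting: given a square from a monomorphism `i` to a fibration `p`, lifts exist degreewise, and the
obstruction to assembling them is a degree-one cocycle from `cokernel i` to `kernel p`. It is a
coboundary as soon as `i` or `p` is a quasi-isomorphism (`hasLiftingProperty_of_mono_of_fibration`).
Disks, cones of identities and one-term complexes serve as test objects, and show that each class is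
determined by lifting against the other.

Factorization: a nonzero acyclic complex contains a nonzero acyclic subcomplex of size bounded
independently of the complex (`exists_acyclic_subcomplex`). Hence every trivial cofibration is a
transfinite composition of pushouts from a set of generators
(`llp_rlp_generatingTrivialCofibrations`), and the small object argument applies.

Consequences: factoring `0 → X` and `X → 0` gives both approximation sequences of the cotorsion
pair. Ext vanishing comes from dimension shifting along `Y → mappingCone (𝟙 Y) → Y⟦1⟧`, whose middle
term is an injective object of complexes. Monomorphisms with their right lifting class form the
other factorization system of the model structure. Finally, `X → 0` factored for a representative
`X` of an object of the derived category gives essential surjectivity, while full faithfulness is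
orthogonality to acyclic complexes. -/

namespace AbelianModel

open CochainComplex HomComplex ZeroObject MorphismProperty

open CochainComplex HomComplex

/-! ### Acyclicity criteria and disk complexes -/

section Complexes

variable {A : Type u} [Category.{v} A] [Abelian A]

/-- The monomorphisms of complexes which are quasi-isomorphisms. -/
def trivialCofibrationsOfComplexes (A : Type u) [Category.{v} A] [Abelian A] :
    MorphismProperty (CochainComplex A ℤ) :=
  fun _ _ f => Mono f ∧ QuasiIso f

/-- The epimorphisms of complexes whose kernel is a homotopy injective complex of injectives. -/
abbrev fibrationsOfComplexes (A : Type u) [Category.{v} A] [Abelian A] :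
    MorphismProperty (CochainComplex A ℤ) :=
  epiWithKernelIn (homotopyInjectiveComplexesOfInjectives A)

lemma shortExact_kernel {E : Type*} [Category* E] [Abelian E] {X Y : E} (f : X ⟶ Y) [Epi f] :
    (ShortComplex.mk _ _ (kernel.condition f)).ShortExact where
  exact := ShortComplex.exact_kernel f

lemma shortExact_cokernel {E : Type*} [Category* E] [Abelian E] {X Y : E} (f : X ⟶ Y) [Mono f] :
    (ShortComplex.mk _ _ (cokernel.condition f)).ShortExact where
  exact := ShortComplex.exact_cokernel f

lemma acyclic_iff_of_iso {K L : CochainComplex A ℤ} (e : K ≅ L) : K.Acyclic ↔ L.Acyclic :=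
  forall_congr' fun i => by
    simp only [HomologicalComplex.exactAt_iff_isZero_homology]
    exact ((HomologicalComplex.homologyFunctor A _ i).mapIso e).isZero_iff

lemma acyclic_of_retract {K L : CochainComplex A ℤ} (i : K ⟶ L) (r : L ⟶ K) (h : i ≫ r = 𝟙 K)
    (hL : L.Acyclic) : K.Acyclic := fun n => by
  have := hL n
  rw [HomologicalComplex.exactAt_iff_isZero_homology] at this ⊢
  rw [IsZero.iff_id_eq_zero, ← HomologicalComplex.homologyMap_id, ← h,
    HomologicalComplex.homologyMap_comp, this.eq_of_tgt (HomologicalComplex.homologyMap i n) 0,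
    zero_comp]

lemma acyclic_of_homotopy_zero {K : CochainComplex A ℤ} (h : Homotopy (𝟙 K) 0) : K.Acyclic :=
  fun n => by
    rw [HomologicalComplex.exactAt_iff_isZero_homology, IsZero.iff_id_eq_zero,
      ← HomologicalComplex.homologyMap_id, h.homologyMap_eq, HomologicalComplex.homologyMap_zero]

lemma quasiIso_iff_acyclic_cokernel {K L : CochainComplex A ℤ} (f : K ⟶ L) [Mono f] :
    QuasiIso f ↔ (cokernel f).Acyclic := by
  have h := shortExact_cokernel f
  refine ⟨fun hf => h.acyclic_X₃ hf, fun hf => ⟨fun n => ?_⟩⟩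
  have hz (i : ℤ) : IsZero ((cokernel f).homology i) :=
    (HomologicalComplex.exactAt_iff_isZero_homology _ _).1 (hf i)
  rw [quasiIsoAt_iff_isIso_homologyMap]
  have h₁ : Mono (HomologicalComplex.homologyMap f n) :=
    (h.homology_exact₁ (n - 1) n (by simp)).mono_g ((hz _).eq_of_src _ _)
  have h₂ : Epi (HomologicalComplex.homologyMap f n) :=
    (h.homology_exact₂ n).epi_f ((hz _).eq_of_tgt _ _)
  exact isIso_of_mono_of_epi _

lemma quasiIso_iff_acyclic_kernel {K L : CochainComplex A ℤ} (f : K ⟶ L) [Epi f] :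
    QuasiIso f ↔ (kernel f).Acyclic := by
  have h := shortExact_kernel f
  refine ⟨fun hf => h.acyclic_X₁ hf, fun hf => ⟨fun n => ?_⟩⟩
  have hz (i : ℤ) : IsZero ((kernel f).homology i) :=
    (HomologicalComplex.exactAt_iff_isZero_homology _ _).1 (hf i)
  rw [quasiIsoAt_iff_isIso_homologyMap]
  have h₁ : Mono (HomologicalComplex.homologyMap f n) :=
    (h.homology_exact₂ n).mono_g ((hz _).eq_of_src _ _)
  have h₂ : Epi (HomologicalComplex.homologyMap f n) :=
    (h.homology_exact₃ n (n + 1) (by simp)).epi_f ((hz _).eq_of_tgt _ _)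
  exact isIso_of_mono_of_epi _

/-- A complex is acyclic if every morphism from a term of it which kills the boundaries kills
the cycles. -/
lemma acyclic_of_forall_comp_eq_zero [EnoughInjectives A] (Q : CochainComplex A ℤ)
    (h : ∀ (m : ℤ) (M : A) [Injective M] (φ : Q.X (m + 1) ⟶ M), Q.d m (m + 1) ≫ φ = 0 →
      kernel.ι (Q.d (m + 1) (m + 1 + 1)) ≫ φ = 0) : Q.Acyclic := fun n => by
  obtain ⟨m, rfl⟩ : ∃ m, n = m + 1 := ⟨n - 1, by lia⟩
  rw [Q.exactAt_iff' m (m + 1) (m + 1 + 1) (by simp) (by simp),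
    ShortComplex.exact_iff_kernel_ι_comp_cokernel_π_zero]
  -- Test on the cokernel of the incoming differential, embedded in an injective.
  have h' := h m _ (cokernel.π (Q.d m (m + 1)) ≫ Injective.ι _) (by simp)
  rw [← Category.assoc] at h'
  exact (cancel_mono (Injective.ι (cokernel (Q.d m (m + 1))))).1 (h'.trans zero_comp.symm)

/-- The disk complex on `M` in degrees `n` and `n + 1`. -/
noncomputable abbrev disk (n : ℤ) (M : A) : CochainComplex A ℤ :=
  HomologicalComplex.double (𝟙 M) (show (ComplexShape.up ℤ).Rel n (n + 1) from rfl)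

/-- Morphisms from a disk complex are determined by a morphism to a term. -/
noncomputable def diskHomEquiv (n : ℤ) (M : A) (K : CochainComplex A ℤ) :
    (disk n M ⟶ K) ≃ (M ⟶ K.X n) :=
  (HomologicalComplex.evalCompCoyonedaCorepresentableByDoubleId
    (show (ComplexShape.up ℤ).Rel n (n + 1) from rfl) (by lia) M).homEquiv

lemma diskHomEquiv_comp {n : ℤ} {M : A} {K L : CochainComplex A ℤ} (f : disk n M ⟶ K)
    (g : K ⟶ L) : diskHomEquiv n M L (f ≫ g) = diskHomEquiv n M K f ≫ g.f n :=
  (HomologicalComplex.evalCompCoyonedaCorepresentableByDoubleId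
    (show (ComplexShape.up ℤ).Rel n (n + 1) from rfl) (by lia) M).homEquiv_comp g f

/-- The morphism `M ⟶ (disk n M).X n`. -/
noncomputable def toDisk (n : ℤ) (M : A) : M ⟶ (disk n M).X n := diskHomEquiv n M _ (𝟙 _)

lemma diskHomEquiv_apply {n : ℤ} {M : A} {K : CochainComplex A ℤ} (f : disk n M ⟶ K) :
    diskHomEquiv n M K f = toDisk n M ≫ f.f n := by
  rw [toDisk, ← diskHomEquiv_comp, Category.id_comp]

lemma acyclic_disk (n : ℤ) (M : A) : (disk n M).Acyclic := by
  intro k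
  let e₀ := HomologicalComplex.doubleXIso₀ (𝟙 M)
    (show (ComplexShape.up ℤ).Rel n (n + 1) from rfl)
  let e₁ := HomologicalComplex.doubleXIso₁ (𝟙 M)
    (show (ComplexShape.up ℤ).Rel n (n + 1) from rfl) (by lia)
  have hd : (disk n M).d n (n + 1) = e₀.hom ≫ e₁.inv := by
    rw [HomologicalComplex.double_d _ _ (by lia), Category.id_comp]
  by_cases h₀ : k = n
  · subst h₀
    rw [HomologicalComplex.exactAt_iff' _ (k - 1) k (k + 1) (by simp) (by simp),
      ShortComplex.exact_iff_mono _ (HomologicalComplex.double_d_eq_zero₁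
        (c := ComplexShape.up ℤ) (𝟙 M) rfl _ _ (by lia))]
    change Mono ((disk k M).d k (k + 1))
    rw [hd]
    infer_instance
  · by_cases h₁ : k = n + 1
    · subst h₁
      rw [HomologicalComplex.exactAt_iff' _ n (n + 1) (n + 1 + 1) (by simp) (by simp),
        ShortComplex.exact_iff_epi _ (HomologicalComplex.double_d_eq_zero₀
          (c := ComplexShape.up ℤ) (𝟙 M) rfl _ _ (by lia))]
      change Epi ((disk n M).d n (n + 1))
      rw [hd]
      infer_instance
    · rw [HomologicalComplex.exactAt_iff]
      exact ShortComplex.exact_of_isZero_X₂ _ (HomologicalComplex.isZero_double_X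
        (c := ComplexShape.up ℤ) (𝟙 M) rfl k h₀ h₁)

/-- The morphism of disks induced by a morphism of objects. -/
noncomputable def diskMap (n : ℤ) {M N : A} (f : M ⟶ N) : disk n M ⟶ disk n N :=
  HomologicalComplex.mkHomFromDouble _ (by lia)
    (f ≫ (HomologicalComplex.doubleXIso₀ (𝟙 N) rfl).inv)
    (f ≫ (HomologicalComplex.doubleXIso₁ (𝟙 N) rfl (by lia)).inv)
    (by simp [HomologicalComplex.double_d (𝟙 N)])
    (fun k _ => by rw [HomologicalComplex.double_d_eq_zero₀ _ _ _ _ (by lia), comp_zero])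

lemma toDisk_eq (n : ℤ) (M : A) : toDisk n M = (HomologicalComplex.doubleXIso₀ (𝟙 M)
    (show (ComplexShape.up ℤ).Rel n (n + 1) from rfl)).inv := by
  exact Category.comp_id _

lemma toDisk_diskMap (n : ℤ) {M N : A} (f : M ⟶ N) :
    toDisk n M ≫ (diskMap n f).f n = f ≫ toDisk n N := by
  simp [toDisk_eq, diskMap]

instance mono_diskMap (n : ℤ) {M N : A} (f : M ⟶ N) [Mono f] : Mono (diskMap n f) := by
  have h₁ : n ≠ n + 1 := by lia
  have h : (ComplexShape.up ℤ).Rel n (n + 1) := rfl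
  refine HomologicalComplex.mono_of_mono_f _ fun k => ?_
  by_cases hk : k = n
  · subst hk
    have e : (diskMap k f).f k = (HomologicalComplex.doubleXIso₀ (𝟙 M) h).hom ≫ f ≫
        (HomologicalComplex.doubleXIso₀ (𝟙 N) h).inv := by
      simp [diskMap]
    rw [e]
    infer_instance
  · by_cases hk : k = n + 1
    · subst hk
      have e : (diskMap n f).f (n + 1) = (HomologicalComplex.doubleXIso₁ (𝟙 M) h h₁).hom ≫ f ≫
          (HomologicalComplex.doubleXIso₁ (𝟙 N) h h₁).inv := by
        simp [diskMap]
      rw [e]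
      infer_instance
    · exact ⟨fun _ _ _ => (HomologicalComplex.isZero_double_X _ _ _ ‹_› hk).eq_of_tgt _ _⟩

end Complexes

open CochainComplex HomComplex ZeroObject

/-! ### Fibrations as the right lifting class of trivial cofibrations -/

section Fibrations

variable {A : Type u} [Category.{v} A] [Abelian A]

lemma isPullback_kernel {E : Type*} [Category* E] [Abelian E] {X Y : E} (p : X ⟶ Y) :
    IsPullback (kernel.ι p) (0 : kernel p ⟶ 0) p 0 :=
  ⟨⟨by simp⟩, ⟨PullbackCone.IsLimit.mk _
    (fun s => kernel.lift p s.fst (by simpa using s.condition))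
    (fun s => by simp) (fun s => (isZero_zero E).eq_of_tgt _ _)
    (fun s m h _ => by simp [← cancel_mono (kernel.ι p), h])⟩⟩

lemma homotopyInjectiveComplexesOfInjectives_of_retract {K L : CochainComplex A ℤ} (i : K ⟶ L)
    (r : L ⟶ K) (h : i ≫ r = 𝟙 K) (hL : homotopyInjectiveComplexesOfInjectives A L) :
    homotopyInjectiveComplexesOfInjectives A K := by
  obtain ⟨h₁, h₂⟩ := hL
  refine ⟨fun n =>
    have := h₁ n
    Retract.injective ⟨i.f n, r.f n, by rw [← HomologicalComplex.comp_f, h,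
      HomologicalComplex.id_f]⟩, ⟨fun {X} f hX => ?_⟩⟩
  obtain ⟨H⟩ := IsKInjective.nonempty_homotopy_zero (f ≫ i) hX
  exact ⟨(Homotopy.ofEq (by simp [h])).trans ((H.compRight r).trans (Homotopy.ofEq (by simp)))⟩

lemma homotopyInjectiveComplexesOfInjectives_iff_of_iso {K L : CochainComplex A ℤ} (e : K ≅ L) :
    homotopyInjectiveComplexesOfInjectives A K ↔ homotopyInjectiveComplexesOfInjectives A L :=
  ⟨homotopyInjectiveComplexesOfInjectives_of_retract e.inv e.hom e.inv_hom_id,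
    homotopyInjectiveComplexesOfInjectives_of_retract e.hom e.inv e.hom_inv_id⟩

lemma homotopyInjectiveComplexesOfInjectives_shift {K : CochainComplex A ℤ}
    (hK : homotopyInjectiveComplexesOfInjectives A K) (n : ℤ) :
    homotopyInjectiveComplexesOfInjectives A (K⟦n⟧) := by
  have := hK.2
  exact ⟨fun i => hK.1 (i + n), inferInstance⟩

lemma homotopyInjectiveComplexesOfInjectives_of_homotopy_zero {K : CochainComplex A ℤ}
    (hK : ∀ n, Injective (K.X n)) (h : Homotopy (𝟙 K) 0) :
    homotopyInjectiveComplexesOfInjectives A K :=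
  ⟨hK, ⟨fun f _ => ⟨(Homotopy.ofEq (by simp)).trans
    ((h.compLeft f).trans (Homotopy.ofEq (by simp)))⟩⟩⟩

/-- The mapping cone of an identity is contractible. -/
noncomputable def coneHomotopyZero (K : CochainComplex A ℤ) :
    Homotopy (𝟙 (mappingCone (𝟙 K))) 0 :=
  mappingCone.liftHomotopy _ _ _ (mappingCone.snd _) 0 (by simp) (by simp)

lemma shortExact_cone (K : CochainComplex A ℤ) :
    (mappingCone.triangleRotateShortComplex (𝟙 K)).ShortExact :=
  HomologicalComplex.shortExact_of_degreewise_shortExact _ fun n =>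
    (mappingCone.triangleRotateShortComplexSplitting (𝟙 K) n).shortExact

lemma injective_cone_X {K L : CochainComplex A ℤ} (f : K ⟶ L) (hK : ∀ n, Injective (K.X n))
    (hL : ∀ n, Injective (L.X n)) (n : ℤ) : Injective ((mappingCone f).X n) :=
  Injective.of_iso (HomologicalComplex.homotopyCofiber.XIsoBiprod f n (n + 1) rfl).symm
    inferInstance

lemma homotopyInjectiveComplexesOfInjectives_cone {K : CochainComplex A ℤ}
    (hK : ∀ n, Injective (K.X n)) :
    homotopyInjectiveComplexesOfInjectives A (mappingCone (𝟙 K)) :=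
  homotopyInjectiveComplexesOfInjectives_of_homotopy_zero (injective_cone_X _ hK hK)
    (coneHomotopyZero K)

lemma homotopyInjectiveComplexesOfInjectives_single (n : ℤ) (M : A) [Injective M] :
    homotopyInjectiveComplexesOfInjectives A
      ((HomologicalComplex.single A (ComplexShape.up ℤ) n).obj M) := by
  have h (i : ℤ) : Injective (((HomologicalComplex.single A (ComplexShape.up ℤ) n).obj M).X i) := by
    by_cases hi : i = n
    · subst hi
      exact Injective.of_iso (HomologicalComplex.singleObjXSelf _ i M).symm inferInstance
    · exact Injective.of_iso ((HomologicalComplex.isZero_single_obj_X _ n M i hi).isoZero).symm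
        inferInstance
  have : CochainComplex.IsStrictlyGE
      ((HomologicalComplex.single A (ComplexShape.up ℤ) n).obj M) n := by
    rw [isStrictlyGE_iff]
    exact fun i hi => HomologicalComplex.isZero_single_obj_X _ n M i (by lia)
  exact ⟨h, isKInjective_of_injective _ n⟩

lemma fibrationsOfComplexes.degreewise {X Y : CochainComplex A ℤ} {p : X ⟶ Y}
    (hp : fibrationsOfComplexes A p) : degreewiseEpiWithInjectiveKernel p := fun n => by
  have := hp.1
  let e := asIso (kernelComparison p (HomologicalComplex.eval A (ComplexShape.up ℤ) n))
  exact ⟨inferInstance, Injective.of_iso e (hp.2.1 n)⟩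

/-- A monomorphism has the left lifting property against a fibration if one of them is a
quasi-isomorphism. -/
lemma hasLiftingProperty_of_mono_of_fibration {K L X Y : CochainComplex A ℤ} (i : K ⟶ L)
    (p : X ⟶ Y) [Mono i] (hp : fibrationsOfComplexes A p) (hip : QuasiIso i ∨ QuasiIso p) :
    HasLiftingProperty i p where
  sq_hasLift {t b} sq := by
    have sq' (n : ℤ) : CommSq (t.f n) (i.f n) (p.f n) (b.f n) :=
      sq.map (HomologicalComplex.eval _ _ n)
    have (n : ℤ) : (sq' n).HasLift := by
      have := (hp.degreewise n).hasLiftingProperty (i.f n)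
      infer_instance
    -- Degreewise lifts need not commute with the differentials; their defect is this cocycle, and a
    -- cochain bounding it corrects them to a chain map.
    let β : Cocycle (cokernel i) (kernel p) 1 :=
      Lifting.cocycle₁ sq (fun n ↦
        { l := (sq' n).lift, fac_left := (sq' n).fac_left, fac_right := (sq' n).fac_right })
        (cokernelIsCokernel i) (kernelIsKernel p) (hπ := by simp) (hι := by simp)
    have := hp.1
    have := hp.2.2
    obtain ⟨α, hα⟩ : ∃ (α : Cochain (cokernel i) (kernel p) 0), δ 0 1 α = β.1 := by
      obtain h | h := hip
      · exact IsKInjective.eq_δ_of_cocycle β ((quasiIso_iff_acyclic_cokernel i).1 h) 0 (by simp)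
      · exact IsKInjective.eq_δ_of_cocycle' β ((quasiIso_iff_acyclic_kernel p).1 h) 0 (by simp)
    exact Lifting.hasLift sq _ (cokernelIsCokernel _) (kernelIsKernel _) α hα

lemma fibrationsOfComplexes_le_rlp :
    fibrationsOfComplexes A ≤ (trivialCofibrationsOfComplexes A).rlp := fun _ _ _ hp _ _ i hi =>
  have := hi.1
  hasLiftingProperty_of_mono_of_fibration i _ hp (Or.inl hi.2)

lemma quasiIso_of_acyclic {K L : CochainComplex A ℤ} (f : K ⟶ L) (hK : K.Acyclic)
    (hL : L.Acyclic) : QuasiIso f where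
  quasiIsoAt n := by
    rw [quasiIsoAt_iff_exactAt]
    · exact hL n
    · exact hK n

lemma trivialCofibration_inr_cone {K : CochainComplex A ℤ} (hK : K.Acyclic) :
    trivialCofibrationsOfComplexes A (mappingCone.inr (𝟙 K)) := by
  have h := shortExact_cone K
  have : Mono (mappingCone.inr (𝟙 K)) := h.mono_f
  exact ⟨this, quasiIso_of_acyclic _ hK (acyclic_of_homotopy_zero (coneHomotopyZero K))⟩

/-- Lifting against maps of disks is injectivity of each term. Lifting against `X ⟶ mappingCone (𝟙
X)` with `X` acyclic factors a map out of `X` through a contractible complex, so it is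
null-homotopic. -/
lemma homotopyInjectiveComplexesOfInjectives_of_hasLiftingProperty {K Z : CochainComplex A ℤ}
    (hZ : IsZero Z) (p : K ⟶ Z) (hp : (trivialCofibrationsOfComplexes A).rlp p) :
    homotopyInjectiveComplexesOfInjectives A K := by
  refine ⟨fun n => ⟨fun {M N} g f _ => ?_⟩, ⟨fun {X} f hX => ?_⟩⟩
  · have := hp (diskMap n f) ⟨inferInstance, quasiIso_of_acyclic _ (acyclic_disk n M)
      (acyclic_disk n N)⟩
    have sq : CommSq ((diskHomEquiv n M K).symm g) (diskMap n f) p 0 := ⟨hZ.eq_of_tgt _ _⟩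
    refine ⟨diskHomEquiv n N K sq.lift, ?_⟩
    have h := congr_arg (diskHomEquiv n M K) sq.fac_left
    rw [Equiv.apply_symm_apply, diskHomEquiv_apply, HomologicalComplex.comp_f,
      ← Category.assoc, toDisk_diskMap, Category.assoc, ← diskHomEquiv_apply] at h
    exact h
  · have := hp _ (trivialCofibration_inr_cone hX)
    have sq : CommSq f (mappingCone.inr (𝟙 X)) p 0 := ⟨hZ.eq_of_tgt _ _⟩
    refine ⟨(Homotopy.ofEq ?_).trans ((((coneHomotopyZero X).compRight sq.lift).compLeft
      (mappingCone.inr (𝟙 X))).trans (Homotopy.ofEq ?_))⟩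
    · simp
    · simp

lemma rlp_trivialCofibrationsOfComplexes :
    (trivialCofibrationsOfComplexes A).rlp = fibrationsOfComplexes A := by
  refine le_antisymm (fun X Y p hp => ⟨?_, ?_⟩) fibrationsOfComplexes_le_rlp
  -- Lifting against `0 ⟶ disk n (Y.X n)` produces a section of `p.f n`.
  · refine HomologicalComplex.epi_of_epi_f _ fun n => ?_
    have := hp (0 : (0 : CochainComplex A ℤ) ⟶ disk n (Y.X n)) ⟨inferInstance, quasiIso_of_acyclic _
      (HomologicalComplex.acyclic_of_isZero _ (isZero_zero _)) (acyclic_disk _ _)⟩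
    have sq : CommSq 0 (0 : (0 : CochainComplex A ℤ) ⟶ disk n (Y.X n)) p
      ((diskHomEquiv n _ Y).symm (𝟙 _)) := ⟨by simp⟩
    have h := congr_arg (diskHomEquiv n _ Y) sq.fac_right
    rw [Equiv.apply_symm_apply, diskHomEquiv_comp] at h
    have : IsSplitEpi (p.f n) := ⟨⟨_, h⟩⟩
    infer_instance
  · refine homotopyInjectiveComplexesOfInjectives_of_hasLiftingProperty (isZero_zero _)
      (0 : kernel p ⟶ 0) ?_
    exact MorphismProperty.of_isPullback (P := (trivialCofibrationsOfComplexes A).rlp)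
      (isPullback_kernel p) hp

end Fibrations

/-! ### Trivial fibrations, and the left lifting class of fibrations -/

section LiftingClasses

variable {A : Type u} [Category.{v} A] [Abelian A]

lemma isPushout_cokernel {E : Type*} [Category* E] [Abelian E] {X Y : E} (f : X ⟶ Y) :
    IsPushout f (0 : X ⟶ 0) (cokernel.π f) (0 : 0 ⟶ cokernel f) :=
  ⟨⟨by simp⟩, ⟨PushoutCocone.IsColimit.mk _
    (fun s => cokernel.desc f s.inl (by simpa using s.condition))
    (fun s => by simp) (fun s => (isZero_zero E).eq_of_src _ _)
    (fun s m h _ => by simp [← cancel_epi (cokernel.π f), h])⟩⟩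

lemma fibration_of_rlp_monomorphisms {X Y : CochainComplex A ℤ} {p : X ⟶ Y}
    (hp : (monomorphisms (CochainComplex A ℤ)).rlp p) : fibrationsOfComplexes A p := by
  rw [← rlp_trivialCofibrationsOfComplexes]
  exact antitone_rlp (fun _ _ _ hf => hf.1) _ hp

/-- An injective complex is a retract of the contractible cone of its identity. -/
lemma acyclic_of_injective (K : CochainComplex A ℤ) [Injective K] : K.Acyclic := by
  have : Mono (mappingCone.inr (𝟙 K)) := (shortExact_cone K).mono_f
  exact acyclic_of_retract _ (Injective.factorThru (𝟙 K) (mappingCone.inr (𝟙 K)))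
    (Injective.comp_factorThru _ _) (acyclic_of_homotopy_zero (coneHomotopyZero K))

lemma rlp_monomorphisms_complexes :
    (monomorphisms (CochainComplex A ℤ)).rlp =
      fibrationsOfComplexes A ⊓ HomologicalComplex.quasiIso A (ComplexShape.up ℤ) := by
  refine le_antisymm (fun X Y p hp => ⟨fibration_of_rlp_monomorphisms hp, ?_⟩)
    (fun X Y p hp U V i (_ : Mono i) => hasLiftingProperty_of_mono_of_fibration _ _ hp.1
      (Or.inr ((HomologicalComplex.mem_quasiIso_iff _).1 hp.2)))
  have := (fibration_of_rlp_monomorphisms hp).1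
  have : Injective (kernel p) := by
    rw [injective_iff_rlp_monomorphisms_zero]
    exact of_isPullback (isPullback_kernel p) hp
  rw [HomologicalComplex.mem_quasiIso_iff, quasiIso_iff_acyclic_kernel]
  exact acyclic_of_injective _

lemma fibrationsOfComplexes_cone {K : CochainComplex A ℤ}
    (hK : homotopyInjectiveComplexesOfInjectives A K) :
    fibrationsOfComplexes A (mappingCone.triangleRotateShortComplex (𝟙 K)).g := by
  have h := shortExact_cone K
  exact ⟨h.epi_g, (homotopyInjectiveComplexesOfInjectives_iff_of_iso
    (h.fIsKernel.conePointUniqueUpToIso (kernelIsKernel _))).1 hK⟩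

/-- The cone of the identity of `K⟦-1⟧` projects onto `K⟦-1⟧⟦1⟧ ≅ K` with kernel `K⟦-1⟧`. Lifting a
map to `K` through this fibration makes it null-homotopic. -/
lemma exists_contractible_fibration {K : CochainComplex A ℤ}
    (hK : homotopyInjectiveComplexesOfInjectives A K) :
    ∃ (T : CochainComplex A ℤ) (π : T ⟶ K), fibrationsOfComplexes A π ∧
      Nonempty (Homotopy (𝟙 T) 0) := by
  let e : K⟦(-1 : ℤ)⟧⟦(1 : ℤ)⟧ ≅ K := (shiftEquiv (CochainComplex A ℤ) (1 : ℤ)).counitIso.app K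
  have h := fibrationsOfComplexes_cone (homotopyInjectiveComplexesOfInjectives_shift hK (-1))
  rw [← rlp_trivialCofibrationsOfComplexes] at h ⊢
  exact ⟨_, _, comp_mem _ _ _ h (rlp_of_isIso _ e.hom), ⟨coneHomotopyZero _⟩⟩

lemma homotopy_zero_of_llp {Q K : CochainComplex A ℤ}
    (hQ : (fibrationsOfComplexes A).llp (0 : 0 ⟶ Q))
    (hK : homotopyInjectiveComplexesOfInjectives A K) (q : Q ⟶ K) : Nonempty (Homotopy q 0) := by
  obtain ⟨T, π, hπ, ⟨h⟩⟩ := exists_contractible_fibration hK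
  have := hQ _ hπ
  have sq : CommSq (0 : 0 ⟶ T) (0 : 0 ⟶ Q) π q := ⟨by simp⟩
  exact ⟨(Homotopy.ofEq (by simp)).trans (((h.compRight π).compLeft sq.lift).trans
    (Homotopy.ofEq (by simp)))⟩

/-- A map `φ` from a term of `Q` to an injective `M` that kills boundaries is a chain map to `M`
placed in one degree. A null-homotopy of it factors `φ` through the outgoing differential, so `φ`
kills cycles. -/
lemma acyclic_of_llp [EnoughInjectives A] {Q : CochainComplex A ℤ}
    (hQ : (fibrationsOfComplexes A).llp (0 : 0 ⟶ Q)) : Q.Acyclic := by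
  refine acyclic_of_forall_comp_eq_zero Q fun m M _ φ hφ => ?_
  obtain ⟨h⟩ := homotopy_zero_of_llp hQ
    (homotopyInjectiveComplexesOfInjectives_single (m + 1) M)
    (HomologicalComplex.mkHomToSingle φ (fun i hi => by
      obtain rfl : i = m := by
        have : i + 1 = m + 1 := hi
        lia
      exact hφ))
  have h' := h.comm (m + 1)
  rw [dNext_eq _ (show (ComplexShape.up ℤ).Rel (m + 1) (m + 1 + 1) from rfl),
    prevD_eq _ (show (ComplexShape.up ℤ).Rel m (m + 1) from rfl)] at h'
  have h'' := kernel.ι (Q.d (m + 1) (m + 1 + 1)) ≫= h' =≫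
    (HomologicalComplex.singleObjXSelf _ (m + 1) M).hom
  simpa using h''

end LiftingClasses

section Grothendieck

variable {A : Type u} [Category.{v} A] [Abelian A] [IsGrothendieckAbelian.{v} A]

/-- Fibrations contain the right lifting class of monomorphisms, so the left class consists of
monomorphisms; its stability under pushout passes the lifting property to `0 ⟶ cokernel f`, which is
therefore acyclic. -/
lemma llp_fibrationsOfComplexes :
    (fibrationsOfComplexes A).llp = trivialCofibrationsOfComplexes A := by
  refine le_antisymm (fun X Y f hf => ?_) ?_
  · have hm : Mono f := by
      have : (monomorphisms (CochainComplex A ℤ)).rlp.llp f :=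
        antitone_llp (fun _ _ _ hp => fibration_of_rlp_monomorphisms hp) _ hf
      rw [IsGrothendieckAbelian.llp_rlp_monomorphisms (isSeparator_separator _)] at this
      exact this
    refine ⟨hm, ?_⟩
    rw [quasiIso_iff_acyclic_cokernel]
    exact acyclic_of_llp (of_isPushout (isPushout_cokernel f).flip hf)
  · rw [le_llp_iff_le_rlp, rlp_trivialCofibrationsOfComplexes]

end Grothendieck

/-! ### Counting subobjects of quotients -/

section Subobjects

variable {E : Type u} [Category.{v} E] [Abelian E]

lemma subobject_le_of_epi {Z W : E} {S S' : Subobject Z} (e : W ⟶ S) [Epi e]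
    (k : W ⟶ S') (h : e ≫ S.arrow = k ≫ S'.arrow) : S ≤ S' := by
  have h₀ : S.arrow ≫ cokernel.π S'.arrow = 0 := by
    rw [← cancel_epi e, ← Category.assoc, h, Category.assoc, cokernel.condition]
    simp
  exact Subobject.le_of_comm ((ShortComplex.exact_cokernel S'.arrow).lift _ h₀)
    ((ShortComplex.exact_cokernel S'.arrow).lift_f _ h₀)

/-- This bounds the number of subobjects of any quotient of `Y` by that of `Y`. -/
lemma subobject_pullback_injective {Y Z : E} (e : Y ⟶ Z) [Epi e] :
    Function.Injective (Subobject.pullback e).obj := by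
  have key (S S' : Subobject Z) (h : (Subobject.pullback e).obj S ≤ (Subobject.pullback e).obj S') :
      S ≤ S' := by
    have : Epi (Subobject.pullbackπ e S) :=
      (epimorphisms E).of_isPullback (Subobject.isPullback e S).flip (.infer_property e)
    refine subobject_le_of_epi (Subobject.pullbackπ e S)
      (Subobject.ofLE _ _ h ≫ Subobject.pullbackπ e S') ?_
    rw [Category.assoc, (Subobject.isPullback e S).w, (Subobject.isPullback e S').w,
      Subobject.ofLE_arrow_assoc]
  exact fun S S' h => le_antisymm (key _ _ h.le) (key _ _ h.ge)

/-- Epimorphisms onto an object with few subobjects can be refined by coproducts of few copies of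
a separator. -/
lemma exists_epi_sigmaDesc_comp [IsGrothendieckAbelian.{v} E] {G : E} (hG : IsSeparator G)
    {P Z : E} (p : P ⟶ Z) [Epi p] {U : Type v} (ι : Subobject Z → U)
    (hι : Function.Injective ι) : ∃ g : U → (G ⟶ P), Epi (Sigma.desc g ≫ p) := by
  -- Keep one map `G ⟶ P` for each image in `Z`: maps with the same image are killed by the same
  -- morphisms out of `Z`, so these representatives already cover `Z`.
  have hg₀ (s : U) : ∃ g₀ : G ⟶ P,
      (∃ g : G ⟶ P, ι (imageSubobject (g ≫ p)) = s) → ι (imageSubobject (g₀ ≫ p)) = s := by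
    by_cases h : ∃ g : G ⟶ P, ι (imageSubobject (g ≫ p)) = s
    · exact ⟨h.choose, fun _ => h.choose_spec⟩
    · exact ⟨0, fun h' => (h h').elim⟩
  choose g hg' using hg₀
  have hg (f : G ⟶ P) : imageSubobject (g (ι (imageSubobject (f ≫ p))) ≫ p) =
      imageSubobject (f ≫ p) := hι (hg' _ ⟨f, rfl⟩)
  have hz {W : E} (f : G ⟶ Z) (u : Z ⟶ W) : f ≫ u = 0 ↔ (imageSubobject f).arrow ≫ u = 0 := by
    rw [← cancel_epi (factorThruImageSubobject f), imageSubobject_arrow_comp_assoc, comp_zero]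
  refine ⟨g, Preadditive.epi_of_cancel_zero _ fun {W} u hu => ?_⟩
  rw [← cancel_epi p, comp_zero]
  refine hG.def _ _ fun f => ?_
  rw [comp_zero, ← Category.assoc, hz, ← hg f, ← hz]
  have := Sigma.ι (fun _ : U => G) (ι (imageSubobject (f ≫ p))) ≫= hu
  simpa using this

end Subobjects

/-! ### Small acyclic subcomplexes of acyclic complexes -/

section Acyclic

variable {A : Type u} [Category.{v} A] [Abelian A] [IsGrothendieckAbelian.{v} A]

attribute [local instance] IsFiltered.isConnected

/-- In a filtered union, a cycle comes from some stage; it suffices that, locally, each cycle of a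
stage becomes a boundary at a later stage. -/
lemma acyclic_of_isColimit {J : Type v} [SmallCategory J] [IsFiltered J]
    (D : J ⥤ CochainComplex A ℤ) [∀ (j j' : J) (f : j ⟶ j'), Mono (D.map f)] {c : Cocone D}
    (hc : IsColimit c)
    (h : ∀ (j : J) (m : ℤ), ∃ (j' : J) (f : j ⟶ j') (E : A)
      (q : E ⟶ kernel ((D.obj j).d (m + 1) (m + 1 + 1))) (x : E ⟶ (D.obj j').X m), Epi q ∧
        q ≫ kernel.ι _ ≫ (D.map f).f (m + 1) = x ≫ (D.obj j').d m (m + 1)) :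
    c.pt.Acyclic := by
  refine acyclic_of_forall_comp_eq_zero _ fun m M _ φ hφ => ?_
  let ev := HomologicalComplex.eval A (ComplexShape.up ℤ) (m + 1)
  have hc' : IsColimit (ev.mapCocone c) := isColimitOfPreserves ev hc
  have hm := hc.mono_ι_app_of_isFiltered
  have (j : J) : Mono ((ev.mapCocone c).ι.app j) := by
    dsimp [ev]
    infer_instance
  have := NatTrans.mono_of_mono_app (ev.mapCocone c).ι
  let z : kernel (c.pt.d (m + 1) (m + 1 + 1)) ⟶ (ev.mapCocone c).pt := kernel.ι _
  -- Exactness of filtered colimits: the cycles of the colimit are the colimit of their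
  -- intersections with the stages.
  have := IsGrothendieckAbelian.IsPresentable.surjectivity.isIso_f hc' z
  rw [← cancel_epi (IsGrothendieckAbelian.IsPresentable.surjectivity.f z), comp_zero]
  refine colimit.hom_ext fun j => ?_
  rw [← Category.assoc, IsGrothendieckAbelian.IsPresentable.surjectivity.hf, comp_zero,
    ← Category.assoc]
  have hp := NatTrans.congr_app (pullback.condition (f := (ev.mapCocone c).ι)
    (g := (Functor.const J).map z)) j
  let y : (pullback (ev.mapCocone c).ι ((Functor.const J).map z)).obj j ⟶ (D.obj j).X (m + 1) :=
    (pullback.fst (ev.mapCocone c).ι ((Functor.const J).map z)).app j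
  have hp' : (pullback.snd (ev.mapCocone c).ι ((Functor.const J).map z)).app j ≫
      kernel.ι (c.pt.d (m + 1) (m + 1 + 1)) = y ≫ (c.ι.app j).f (m + 1) := hp.symm
  have hy : y ≫ (D.obj j).d (m + 1) (m + 1 + 1) = 0 := by
    rw [← cancel_mono ((c.ι.app j).f (m + 1 + 1)), Category.assoc,
      ← HomologicalComplex.Hom.comm, ← Category.assoc, ← hp']
    simp
  obtain ⟨j', f, E, q, x, hq, hqx⟩ := h j m
  have h₀ : kernel.ι ((D.obj j).d (m + 1) (m + 1 + 1)) ≫ (c.ι.app j).f (m + 1) ≫ φ = 0 := by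
    rw [← cancel_epi q, comp_zero, ← c.w f, HomologicalComplex.comp_f, Category.assoc]
    have := hqx =≫ ((c.ι.app j').f (m + 1) ≫ φ)
    simp only [Category.assoc] at this
    have h₁ : (D.obj j').d m (m + 1) ≫ (c.ι.app j').f (m + 1) ≫ φ = 0 := by
      rw [← HomologicalComplex.Hom.comm_assoc]
      exact (congr_arg _ hφ).trans comp_zero
    rw [this, h₁, comp_zero]
  rw [hp', ← kernel.lift_ι _ y hy, Category.assoc, Category.assoc, h₀, comp_zero]

end Acyclic

section Deconstruction

variable {A : Type u} [Category.{v} A] [Abelian A] [IsGrothendieckAbelian.{v} A]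

/-- The coproduct of the disks on `G` in all degrees, with multiplicity `T`. -/
noncomputable abbrev diskCoproduct (G : A) (T : Type v) : CochainComplex A ℤ :=
  ∐ (fun x : ℤ × T => disk x.1 G)

/-- A type bounding the number of subobjects of the terms of quotients of
`diskCoproduct G T`. -/
abbrev subobjectIndex (G : A) (T : Type v) : Type v :=
  Shrink.{v} (Σ n : ℤ, Subobject ((diskCoproduct G T).X n))

lemma exists_injective_subobjectIndex (G : A) (T : Type v) {B : CochainComplex A ℤ}
    (e : diskCoproduct G T ⟶ B) [Epi e] (n : ℤ) {Z : A} (z : Z ⟶ B.X n) [Mono z] :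
    ∃ ι : Subobject Z → subobjectIndex G T, Function.Injective ι := by
  refine ⟨fun S => equivShrink _ ⟨n, (Subobject.pullback (e.f n)).obj
    ((Subobject.map z).obj S)⟩, fun S S' h => ?_⟩
  have h := (equivShrink _).injective h
  rw [Sigma.mk.injEq] at h
  exact Subobject.map_obj_injective z (subobject_pullback_injective _ (eq_of_heq h.2))

/-- Cycles of `B` are locally boundaries in `Q`. Bounded counting of subobjects allows primitives to
be chosen from few copies of `G`; adjoining the corresponding disks kills all cycles of `B` while
keeping an explicit bound on the size. -/
lemma exists_larger_subcomplex {G : A} (hG : IsSeparator G) (T : Type v)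
    {Q : CochainComplex A ℤ} (hQ : Q.Acyclic) (B : Subobject Q)
    (hB : ∃ e : diskCoproduct G T ⟶ B, Epi e) :
    ∃ (B' : Subobject Q) (h : B ≤ B'),
      (∃ e' : diskCoproduct G (T ⊕ subobjectIndex G T) ⟶ B', Epi e') ∧
      ∀ m : ℤ, ∃ (E : A) (q : E ⟶ kernel ((B : CochainComplex A ℤ).d (m + 1) (m + 1 + 1)))
        (x : E ⟶ (B' : CochainComplex A ℤ).X m), Epi q ∧
          q ≫ kernel.ι _ ≫ (Subobject.ofLE B B' h).f (m + 1) =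
            x ≫ (B' : CochainComplex A ℤ).d m (m + 1) := by
  obtain ⟨e, he⟩ := hB
  have hr (m : ℤ) : ∃ (P : A)
      (π : P ⟶ kernel ((B : CochainComplex A ℤ).d (m + 1) (m + 1 + 1))) (_ : Epi π)
      (y : P ⟶ Q.X m),
      π ≫ kernel.ι _ ≫ B.arrow.f (m + 1) = y ≫ Q.d m (m + 1) := by
    have h := hQ (m + 1)
    rw [Q.exactAt_iff' m (m + 1) (m + 1 + 1) (by simp) (by simp),
      ShortComplex.exact_iff_exact_up_to_refinements] at h
    obtain ⟨P, π, hπ, y, hy⟩ := h (kernel.ι ((B : CochainComplex A ℤ).d (m + 1) (m + 1 + 1)) ≫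
      B.arrow.f (m + 1)) (by
        change (kernel.ι _ ≫ B.arrow.f (m + 1)) ≫ Q.d (m + 1) (m + 1 + 1) = 0
        rw [Category.assoc, HomologicalComplex.Hom.comm, kernel.condition_assoc, zero_comp])
    exact ⟨P, π, hπ, y, hy⟩
  choose P π hπ y hy using hr
  have hg (m : ℤ) : ∃ g : subobjectIndex G T → (G ⟶ P m), Epi (Sigma.desc g ≫ π m) := by
    obtain ⟨ι, hι⟩ := exists_injective_subobjectIndex G T e (m + 1)
      (kernel.ι ((B : CochainComplex A ℤ).d (m + 1) (m + 1 + 1)))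
    exact exists_epi_sigmaDesc_comp hG (π m) ι hι
  choose g hg using hg
  let c : ∀ x : ℤ × (T ⊕ subobjectIndex G T), disk x.1 G ⟶ Q
    | (m, Sum.inl t) => Sigma.ι (fun x : ℤ × T => disk x.1 G) (m, t) ≫ e ≫ B.arrow
    | (m, Sum.inr s) => (diskHomEquiv m G Q).symm (g m s ≫ y m)
  let e₁ : diskCoproduct G (T ⊕ subobjectIndex G T) ⟶ Q := Sigma.desc c
  have hc (x) : Sigma.ι _ x ≫ factorThruImageSubobject e₁ ≫ (imageSubobject e₁).arrow = c x := by
    rw [imageSubobject_arrow_comp]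
    exact Sigma.ι_desc _ _
  have hle : B ≤ imageSubobject e₁ := by
    refine subobject_le_of_epi e (Sigma.desc (fun x => Sigma.ι
      (fun x : ℤ × (T ⊕ subobjectIndex G T) => disk x.1 G) (x.1, Sum.inl x.2) ≫
        factorThruImageSubobject e₁)) ?_
    refine Sigma.hom_ext _ _ fun x => ?_
    rw [Sigma.ι_desc_assoc, Category.assoc, hc]
  refine ⟨imageSubobject e₁, hle, ⟨factorThruImageSubobject e₁, inferInstance⟩, fun m =>
    ⟨_, Sigma.desc (g m) ≫ π m, Sigma.desc (fun s => diskHomEquiv m G _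
      (Sigma.ι (fun x : ℤ × (T ⊕ subobjectIndex G T) => disk x.1 G) (m, Sum.inr s) ≫
        factorThruImageSubobject e₁)), hg m, ?_⟩⟩
  rw [← cancel_mono ((imageSubobject e₁).arrow.f (m + 1))]
  refine Sigma.hom_ext _ _ fun s => ?_
  simp only [Category.assoc]
  rw [← HomologicalComplex.comp_f, Subobject.ofLE_arrow, hy, ← HomologicalComplex.Hom.comm,
    Sigma.ι_desc_assoc, Sigma.ι_desc_assoc, ← Category.assoc,
    ← Category.assoc (diskHomEquiv _ _ _ _), ← diskHomEquiv_comp,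
    (Category.assoc _ _ _).trans (hc (m, Sum.inr s))]
  simp [c]

/-- The iterated bounds for the sizes of the subcomplexes. -/
def sizeIndex (G : A) : ℕ → Type v
  | 0 => PUnit
  | k + 1 => sizeIndex G k ⊕ subobjectIndex G (sizeIndex G k)

/-- Start from the image of a nonzero map from a disk and enlarge countably often; each stage's
cycles bound in the next, so the union is acyclic. The covering complex depends only on `G`, not on
`Q`. -/
lemma exists_acyclic_subcomplex {G : A} (hG : IsSeparator G) {Q : CochainComplex A ℤ}
    (hQ : Q.Acyclic) (hQ' : ¬ IsZero Q) :
    ∃ (B : CochainComplex A ℤ) (b : B ⟶ Q), Mono b ∧ B.Acyclic ∧ ¬ IsZero B ∧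
      ∃ e : diskCoproduct G (Σ k, sizeIndex G k) ⟶ B, Epi e := by
  obtain ⟨n, f, hf⟩ : ∃ (n : ℤ) (f : G ⟶ Q.X n), f ≠ 0 := by
    by_contra! h
    refine hQ' ((IsZero.iff_id_eq_zero _).2 ?_)
    ext n
    exact hG.def _ _ fun f => by simp [h n f]
  classical
  -- The source has a disk in every degree; only the one in degree `n` is mapped nontrivially.
  let c (x : ℤ × PUnit.{v + 1}) : disk x.1 G ⟶ Q :=
    if h : x.1 = n then (diskHomEquiv x.1 G Q).symm (f ≫ eqToHom (by rw [h])) else 0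
  let e₀ : diskCoproduct G PUnit.{v + 1} ⟶ Q := Sigma.desc c
  have he₀ : e₀ ≠ 0 := by
    intro h
    apply hf
    have h₁ : c (n, PUnit.unit) = 0 :=
      (Sigma.ι_desc c _).symm.trans ((congrArg (Sigma.ι _ (n, PUnit.unit) ≫ ·) h).trans comp_zero)
    have h₂ := congr_arg (diskHomEquiv n G Q) h₁
    simpa [c, diskHomEquiv_apply] using h₂
  have hstep (k : ℕ) (B : Subobject Q) (hB : ∃ e : diskCoproduct G (sizeIndex G k) ⟶ B, Epi e) :=
    exists_larger_subcomplex hG (sizeIndex G k) hQ B hB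
  choose next hle hnext hcyc using hstep
  have h0 : ∃ e : diskCoproduct G (sizeIndex G 0) ⟶
      (imageSubobject e₀ : CochainComplex A ℤ), Epi e :=
    ⟨factorThruImageSubobject e₀, (inferInstance : Epi (factorThruImageSubobject e₀))⟩
  let S : ∀ k, { B : Subobject Q // ∃ e : diskCoproduct G (sizeIndex G k) ⟶ B, Epi e } :=
    Nat.rec ⟨imageSubobject e₀, h0⟩
      (fun k B => ⟨next k B.1 B.2, hnext k B.1 B.2⟩)
  have hmono : Monotone (fun k => (S k).1) := monotone_nat_of_le_succ fun k => hle k _ _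
  let F : ULift.{v} ℕ ⥤ MonoOver Q :=
    { obj j := MonoOver.mk (S j.down).1.arrow
      map {X Y} φ := MonoOver.homMk (Subobject.ofLE _ _ 
        (hmono (show X.down ≤ Y.down from (leOfHom φ : X ≤ Y)))) }
  let D : ULift.{v} ℕ ⥤ CochainComplex A ℤ := F ⋙ MonoOver.forget _ ⋙ Over.forget _
  let b : colimit D ⟶ Q := colimit.desc D (Cocone.mk Q
    { app j := (S j.down).1.arrow
      naturality j j' φ := (Subobject.ofLE_arrow _).trans (Category.comp_id _).symm })
  have hb (j : ULift.{v} ℕ) : colimit.ι D j ≫ b = (S j.down).1.arrow := colimit.ι_desc _ _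
  have hm (j j' : ULift.{v} ℕ) (φ : j ⟶ j') : Mono (D.map φ) :=
    inferInstanceAs (Mono (Subobject.ofLE _ _ 
      (hmono (show j.down ≤ j'.down from (leOfHom φ : j ≤ j')))))
  choose ek hek using fun k => (S k).2
  refine ⟨colimit D, b, IsGrothendieckAbelian.mono_of_isColimit_monoOver F (colimit.isColimit D) b
    hb, acyclic_of_isColimit D (colimit.isColimit D) fun j m => ?_, fun h => he₀ ?_,
    Sigma.desc (fun x => Sigma.ι (fun x : ℤ × sizeIndex G x.2.1 => disk x.1 G) (x.1, x.2.2) ≫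
      ek x.2.1 ≫ colimit.ι D ⟨x.2.1⟩), ?_⟩
  · obtain ⟨E, q, x, hq, hqx⟩ := hcyc j.down _ (S j.down).2 m
    exact ⟨⟨j.down + 1⟩, homOfLE (Nat.le_succ j.down), E, q, x, hq, hqx⟩
  · rw [← imageSubobject_arrow_comp e₀]
    have := hb ⟨0⟩
    rw [h.eq_of_tgt (colimit.ι D ⟨0⟩) 0, zero_comp] at this
    rw [show (imageSubobject e₀).arrow = 0 from this.symm, comp_zero]
  · refine Preadditive.epi_of_cancel_zero _ fun {W} g hg => colimit.hom_ext fun j => ?_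
    refine (cancel_epi (ek j.down)).1 (Sigma.hom_ext _ _ fun x => ?_)
    have := Sigma.ι (fun x : ℤ × (Σ k, sizeIndex G k) => disk x.1 G) (x.1, ⟨j.down, x.2⟩) ≫= hg
    simp only [Sigma.ι_desc_assoc, Category.assoc, comp_zero] at this
    refine (congrArg (_ ≫ ·) (Category.assoc _ _ _).symm).trans  (this.trans ?_)
    erw [comp_zero, comp_zero]
    exact (comp_zero (C := CochainComplex A ℤ)).symm

end Deconstruction

/-! ### Transfinite filtrations by subobjects -/

section TransfiniteFiltration

lemma property_ofLE_congr {C : Type u} [Category.{v} C] {X : C} (W : MorphismProperty C)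
    {S T S' T' : Subobject X} (h : S ≤ T)
    (hS : S = S') (hT : T = T') (hW : W (Subobject.ofLE S T h)) :
    W (Subobject.ofLE S' T' (by rwa [← hS, ← hT])) := by
  subst hS hT
  exact hW

lemma le_transfiniteIterate {I J : Type*} [CompleteLattice I] (φ : I → I) (hφ : ∀ i, i ≤ φ i)
    [LinearOrder J] [OrderBot J] [SuccOrder J] [WellFoundedLT J] (i : I) (j : J) :
    i ≤ transfiniteIterate φ j i :=
  (transfiniteIterate_bot φ i).symm.le.trans (monotone_transfiniteIterate φ i hφ bot_le)

variable {C : Type u} [Category.{v} C] [Abelian C] [IsGrothendieckAbelian.{v} C]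

/-- The functor given by the iteration of an increasing map on subobjects. -/
noncomputable abbrev iterationFunctor {X : C} (φ : Subobject X → Subobject X) (hφ : ∀ S, S ≤ φ S)
    (A₀ : Subobject X) (J : Type v) [LinearOrder J] [OrderBot J] [SuccOrder J]
    [WellFoundedLT J] : J ⥤ MonoOver X where
  obj j := MonoOver.mk (transfiniteIterate φ j A₀).arrow
  map f := MonoOver.homMk (Subobject.ofLE _ _ (monotone_transfiniteIterate _ _ hφ (leOfHom f)))

instance isWellOrderContinuous_iterationFunctor {X : C} (φ : Subobject X → Subobject X)
    (hφ : ∀ S, S ≤ φ S) (A₀ : Subobject X) (J : Type v) [LinearOrder J] [OrderBot J]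
    [SuccOrder J] [WellFoundedLT J] :
    (iterationFunctor φ hφ A₀ J ⋙ MonoOver.forget _ ⋙ Over.forget _).IsWellOrderContinuous where
  nonempty_isColimit m hm := ⟨by
    have := hm.nonempty_Iio.to_subtype
    let c := (Set.principalSegIio m).cocone (iterationFunctor φ hφ A₀ J ⋙ MonoOver.forget _)
    have : Mono c.pt.hom := inferInstanceAs (Mono (transfiniteIterate φ m A₀).arrow)
    apply IsGrothendieckAbelian.isColimitMapCoconeOfSubobjectMkEqISup
      ((Set.principalSegIio m).monotone.functor ⋙ iterationFunctor φ hφ A₀ J) c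
    change Subobject.mk (transfiniteIterate φ m A₀).arrow = ⨆ x : Set.Iio m,
      Subobject.mk (transfiniteIterate φ x.1 A₀).arrow
    simp only [Subobject.mk_arrow]
    exact transfiniteIterate_limit φ A₀ m hm⟩

/-- Stage `j` is the transfinite composition of the earlier steps, and each of these lies in `W` by
well-founded induction; `hW` is thus needed only at subobjects already reached through `W`. -/
lemma iteration_induction {X : C} (φ : Subobject X → Subobject X)
    (hφ : ∀ S, S ≤ φ S) (A₀ : Subobject X) (W : MorphismProperty C)
    [IsStableUnderTransfiniteComposition.{v} W]
    (hW : ∀ (S : Subobject X) (h : A₀ ≤ S), W (Subobject.ofLE _ _ h) →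
      W (Subobject.ofLE _ _ (hφ S)))
    {J : Type v} [LinearOrder J] [OrderBot J] [SuccOrder J] [WellFoundedLT J] (j : J) :
    W (Subobject.ofLE _ _ (le_transfiniteIterate φ hφ A₀ j)) := by
  induction j using WellFoundedLT.induction with
  | ind j hj =>
  let F : J ⥤ C := iterationFunctor φ hφ A₀ J ⋙ MonoOver.forget _ ⋙ Over.forget _
  let t : W.TransfiniteCompositionOfShape (Set.Iic j) (F.map (homOfLE bot_le : ⊥ ⟶ j)) :=
    { F := (Set.initialSegIic j).monotone.functor ⋙ F
      isoBot := Iso.refl _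
      incl :=
        { app k := F.map (homOfLE k.2)
          naturality k k' h :=
            (F.map_comp ((Set.initialSegIic j).monotone.functor.map h) (homOfLE k'.2)).symm.trans
              (Category.comp_id (F.map (homOfLE k.2))).symm }
      fac := Category.id_comp (F.map (homOfLE bot_le))
      isColimit := colimitOfDiagramTerminal isTerminalTop _
      map_mem k hk := by
        have h := hW _ _ (hj k.1 (lt_of_le_of_ne k.2 fun h => hk fun x hx => by
          exact Subtype.coe_le_coe.1 (x.2.trans_eq h.symm)))
        refine property_ofLE_congr W _ rfl ?_ h
        rw [Set.Iic.succ_eq_of_not_isMax hk]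
        exact (transfiniteIterate_succ _ _ _ (Set.not_isMax_coe _ hk)).symm }
  exact property_ofLE_congr W _ (transfiniteIterate_bot _ _) rfl
    (W.transfiniteCompositionsOfShape_le _ _ t.mem)

lemma llp_rlp_of_forall_subobject {X : C} (A₀ : Subobject X) (I : MorphismProperty C)
    (hI : ∀ (S : Subobject X) (h : A₀ ≤ S), I.rlp.llp (Subobject.ofLE _ _ h) → S ≠ ⊤ →
      ∃ (S' : Subobject X) (h' : S < S'), I.rlp.llp (Subobject.ofLE _ _ h'.le)) :
    I.rlp.llp A₀.arrow := by
  classical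
  -- The default `⊤` makes `φ` strictly increasing below `⊤`, as termination requires. By `hI` it is
  -- never used at a proper subobject reached through the lifting class.
  let φ (S : Subobject X) : Subobject X :=
    if h : ∃ (S' : Subobject X) (h' : S < S'), I.rlp.llp (Subobject.ofLE _ _ h'.le) then
      h.choose else ⊤
  have hφ (S) : S ≤ φ S := by
    by_cases h : ∃ (S' : Subobject X) (h' : S < S'), I.rlp.llp (Subobject.ofLE _ _ h'.le)
    · have := h.choose_spec.choose
      simpa only [φ, dif_pos h] using this.le
    · simp [φ, dif_neg h]
  have hφ' (S) (hS : S ≠ ⊤) : S < φ S := by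
    by_cases h : ∃ (S' : Subobject X) (h' : S < S'), I.rlp.llp (Subobject.ofLE _ _ h'.le)
    · have := h.choose_spec.choose
      simpa only [φ, dif_pos h] using this
    · simpa [φ, dif_neg h] using lt_top_iff_ne_top.2 hS
  have hφt : φ ⊤ = ⊤ := top_le_iff.1 (hφ _)
  -- An iteration longer than the number of subobjects cannot be injective, so it reaches `⊤`.
  let κ := Order.succ (Cardinal.mk (Shrink.{v} (Subobject X)))
  have : Nonempty κ.ord.ToType := by simp [κ]
  have := WellFoundedLT.toOrderBot κ.ord.ToType
  have hκ : HasCardinalLT (Subobject X) (Cardinal.mk κ.ord.ToType) :=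
    lt_of_lt_of_le (Order.lt_succ _) (by simp [κ])
  obtain ⟨j, hj⟩ := top_mem_range_transfiniteIterate (J := κ.ord.ToType) φ A₀ hφ' hφt
    (fun h ↦ by simpa [hasCardinalLT_iff_cardinal_mk_lt] using hκ.of_injective _ h)
  have := iteration_induction φ hφ A₀ I.rlp.llp (fun S h hS => by
    by_cases hS' : S = ⊤
    · subst hS'
      have := property_ofLE_congr I.rlp.llp (le_refl ⊤) rfl hφt.symm
        (by rw [Subobject.ofLE_refl]; exact I.rlp.llp.id_mem _)
      exact this
    · have h := hI S h hS hS'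
      exact property_ofLE_congr _ _ rfl (dif_pos h).symm h.choose_spec.choose_spec) j
  have := property_ofLE_congr _ _ rfl hj this
  rw [← Subobject.ofLE_arrow le_top]
  have : IsIso (⊤ : Subobject X).arrow := inferInstance
  exact I.rlp.llp.comp_mem _ _ ‹_› (I.rlp.llp.of_isIso _)

end TransfiniteFiltration

/-! ### A generating set of trivial cofibrations and the small object argument -/

section Generators

variable (A : Type u) [Category.{v} A] [Abelian A] [IsGrothendieckAbelian.{v} A]

/-- A complex whose quotients include sufficiently many small subcomplexes of any complex. -/
noncomputable abbrev generatorCoproduct : CochainComplex A ℤ :=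
  ∐ (fun _ : Shrink.{v} (Subobject (diskCoproduct (separator A)
    (Σ k, sizeIndex (separator A) k))) => separator (CochainComplex A ℤ))

/-- The inclusions with acyclic cokernel of the subobjects of quotients of
`generatorCoproduct A`. -/
def generatingTrivialCofibrations : MorphismProperty (CochainComplex A ℤ) :=
  ofHoms (fun x : Σ N : Subobject (generatorCoproduct A),
    { S : Subobject (cokernel N.arrow) // (cokernel S.arrow).Acyclic } => x.2.1.arrow)

instance : MorphismProperty.IsSmall.{v} (generatingTrivialCofibrations A) := by
  dsimp [generatingTrivialCofibrations]
  infer_instance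

variable {A}

lemma generatingTrivialCofibrations_le :
    generatingTrivialCofibrations A ≤ trivialCofibrationsOfComplexes A := by
  rintro _ _ _ ⟨_, S, hS⟩
  exact ⟨inferInstance, (quasiIso_iff_acyclic_cokernel S.arrow).2 hS⟩

lemma llp_rlp_generatingTrivialCofibrations_le :
    (generatingTrivialCofibrations A).rlp.llp ≤ trivialCofibrationsOfComplexes A := by
  rw [← llp_fibrationsOfComplexes, ← rlp_trivialCofibrationsOfComplexes]
  exact antitone_llp (antitone_rlp generatingTrivialCofibrations_le)

/-- Choose a small nonzero acyclic `B` in `cokernel i` and a small subcomplex `V` of `X` mapping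
onto `B`. Then `K ∩ V ⟶ V` has cokernel `B`, so it is a generator up to isomorphism, and its pushout
is `K ⟶ K + V`, a proper enlargement of `K` inside `X`. -/
lemma exists_pushouts_generatingTrivialCofibrations {K X : CochainComplex A ℤ} (i : K ⟶ X)
    (hi : trivialCofibrationsOfComplexes A i) (hi' : ¬ IsIso i) :
    ∃ (X' : CochainComplex A ℤ) (j : K ⟶ X') (p : X' ⟶ X),
      (generatingTrivialCofibrations A).pushouts j ∧ ¬ IsIso j ∧ Mono p ∧ j ≫ p = i := by
  have := hi.1
  have hQ := (quasiIso_iff_acyclic_cokernel i).1 hi.2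
  have hQ' : ¬ IsZero (cokernel i) := fun h => hi' (by
    have := Preadditive.epi_of_isZero_cokernel i h
    exact isIso_of_mono_of_epi i)
  obtain ⟨B, b, _, hB, hB', e, _⟩ := exists_acyclic_subcomplex (isSeparator_separator A) hQ hQ'
  obtain ⟨g, hg⟩ := exists_epi_sigmaDesc_comp (isSeparator_separator (CochainComplex A ℤ))
    (pullback.snd (cokernel.π i) b) (fun S => equivShrink.{v} _ ((Subobject.pullback e).obj S))
    ((equivShrink _).injective.comp (subobject_pullback_injective e))
  let q : generatorCoproduct A ⟶ B := Sigma.desc g ≫ pullback.snd _ _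
  let f : generatorCoproduct A ⟶ X := Sigma.desc g ≫ pullback.fst _ _
  have hq : Epi q := hg
  have hqf : q ≫ b = f ≫ cokernel.π i := by
    simp only [q, f, Category.assoc, pullback.condition]
  -- The image `V` of `f` is presented as a quotient of `generatorCoproduct A`, to match the
  -- indexing of the generators.
  let N := kernelSubobject f
  have hN : N.arrow ≫ f = 0 := kernelSubobject_arrow_comp f
  let v : cokernel N.arrow ⟶ X := cokernel.desc _ f hN
  let t : cokernel N.arrow ⟶ B := cokernel.desc _ q (by
    rw [← cancel_mono b, Category.assoc, hqf, reassoc_of% hN, zero_comp, zero_comp])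
  have ht : t ≫ b = v ≫ cokernel.π i := by
    rw [← cancel_epi (cokernel.π N.arrow), cokernel.π_desc_assoc, cokernel.π_desc_assoc, hqf]
  have : Epi t := by
    have : Epi (cokernel.π N.arrow ≫ t) := by rwa [cokernel.π_desc]
    exact epi_of_epi (cokernel.π N.arrow) t
  have : Mono v := by
    have h : v = (cokernel.mapIso N.arrow (kernel.ι f) (kernelSubobjectIso f) (Iso.refl _)
        (by simp [N])).hom ≫ Abelian.factorThruCoimage f := by
      rw [← cancel_epi (cokernel.π N.arrow)]
      simp [v]
    rw [h]
    infer_instance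
  have hS : (ShortComplex.mk (pullback.snd i v) t (by
      rw [← cancel_mono b, Category.assoc, ht, ← pullback.condition_assoc, cokernel.condition,
        comp_zero, zero_comp])).ShortExact :=
    { exact := ShortComplex.exact_of_f_is_kernel _ (KernelFork.IsLimit.ofι' _ _ fun {Z} s hs => by
        have h : (s ≫ v) ≫ cokernel.π i = 0 :=
          ((Category.assoc _ _ _).trans (congrArg (s ≫ ·) ht.symm)).trans
            (((Category.assoc _ _ _).symm.trans (congrArg (· ≫ b) hs)).trans zero_comp)
        exact ⟨pullback.lift ((ShortComplex.exact_cokernel i).lift _ h) s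
          ((ShortComplex.exact_cokernel i).lift_f _ h), pullback.lift_snd _ _ _⟩) }
  let S := Subobject.mk (pullback.snd i v)
  have hS' : (cokernel S.arrow).Acyclic := by
    refine (acyclic_iff_of_iso ?_).2 hB
    exact cokernel.mapIso S.arrow (pullback.snd i v) (Subobject.underlyingIso _) (Iso.refl _)
      (by simp [S]) ≪≫ IsColimit.coconePointUniqueUpToIso (cokernelIsCokernel _) hS.gIsCokernel
  have hJ : generatingTrivialCofibrations A S.arrow := ofHoms.mk (f := fun x :
    Σ N : Subobject (generatorCoproduct A),
    { S : Subobject (cokernel N.arrow) // (cokernel S.arrow).Acyclic } => x.2.1.arrow) ⟨N, S, hS'⟩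
  refine ⟨pushout (pullback.fst i v) (pullback.snd i v), pushout.inl _ _,
    pushout.desc i v pullback.condition,
    ⟨_, _, _, (Subobject.underlyingIso _).hom ≫ pullback.fst _ _,
    pushout.inr _ _, hJ,
    (IsPushout.of_hasPushout (pullback.fst i v) (pullback.snd i v)).of_iso
      ((Subobject.underlyingIso _).symm) (Iso.refl _) (Iso.refl _)
      (Iso.refl _) (by simp)
      ((Category.comp_id _).trans (Subobject.underlyingIso_arrow _).symm) (by simp)
      (by simp)⟩, ?_, ?_, pushout.inl_desc _ _ _⟩
  -- If `K ⟶ K + V` were invertible, `V` would lie in `K` and have zero image in `cokernel i`,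
  -- forcing `B = 0`.
  · intro h
    have hv : v = (pushout.inr _ _ ≫ inv (pushout.inl (pullback.fst i v) (pullback.snd i v))) ≫
        i := by
      have : inv (pushout.inl (pullback.fst i v) (pullback.snd i v)) ≫ i =
          pushout.desc i v pullback.condition := by
        rw [IsIso.inv_comp_eq, pushout.inl_desc]
      rw [Category.assoc, this, pushout.inr_desc]
    refine hB' (IsZero.of_mono_eq_zero b ?_)
    rw [← cancel_epi t, ht, hv]
    simp
  · exact (IsPushout.of_hasPushout _ _).mono_of_isPullback_of_mono
      (IsPullback.of_hasPullback i v) _ (pushout.inl_desc _ _ _) (pushout.inr_desc _ _ _)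

lemma llp_rlp_generatingTrivialCofibrations :
    (generatingTrivialCofibrations A).rlp.llp = trivialCofibrationsOfComplexes A := by
  refine le_antisymm llp_rlp_generatingTrivialCofibrations_le fun K X i hi => ?_
  have := hi.1
  have hX : (generatingTrivialCofibrations A).rlp.llp (Subobject.mk i).arrow := by
    refine llp_rlp_of_forall_subobject _ _ fun S h hS hS' => ?_
    have := (llp_rlp_generatingTrivialCofibrations_le _ hS).2
    have h₁ : QuasiIso (Subobject.mk i).arrow := by
      have := hi.2
      rw [← Subobject.underlyingIso_hom_comp_eq_mk]
      infer_instance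
    -- Two-out-of-three: the remaining inclusion of `S` in `X` is again a trivial cofibration, so it
    -- can be enlarged in turn.
    have h₂ : QuasiIso S.arrow := by
      rw [← Subobject.ofLE_arrow h] at h₁
      exact (quasiIso_iff_comp_left (Subobject.ofLE _ _ h) S.arrow).1 h₁
    obtain ⟨X', j, p, hj, hj', _, fac⟩ := exists_pushouts_generatingTrivialCofibrations S.arrow
      ⟨inferInstance, h₂⟩ (by rwa [Subobject.isIso_arrow_iff_eq_top])
    have hle : S ≤ Subobject.mk p := Subobject.le_mk_of_comm j fac
    refine ⟨Subobject.mk p, lt_of_le_not_ge hle fun h' => hj' ?_, ?_⟩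
    · have : Subobject.ofMkLE _ _ h' ≫ S.arrow = p := by simp
      exact ⟨Subobject.ofMkLE _ _ h', by rw [← cancel_mono S.arrow]; simp [fac],
        by rw [← cancel_mono p]; simp [fac]⟩
    · have : Subobject.ofLE _ _ hle = j ≫ (Subobject.underlyingIso p).inv := by
        rw [← cancel_mono (Subobject.mk p).arrow]
        simp [fac]
      rw [this]
      exact comp_mem _ _ _ (pushouts_le_llp_rlp _ _ hj) (of_isIso _ _)
  rw [← Subobject.underlyingIso_arrow i]
  exact comp_mem _ _ _ (of_isIso _ _) hX

lemma rlp_generatingTrivialCofibrations :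
    (generatingTrivialCofibrations A).rlp = fibrationsOfComplexes A := by
  rw [← rlp_llp_rlp, llp_rlp_generatingTrivialCofibrations, rlp_trivialCofibrationsOfComplexes]

instance hasSmallObjectArgument_generatingTrivialCofibrations :
    HasSmallObjectArgument.{v} (generatingTrivialCofibrations A) := by
  -- `κ` exceeds the number of subobjects of every generator's source, so maps from these sources
  -- commute with colimits of `κ`-chains of monomorphisms.
  obtain ⟨κ, hκ', hκ⟩ := HasCardinalLT.exists_regular_cardinal.{v}
    (Σ x : Σ N : Subobject (generatorCoproduct A),
      { S : Subobject (cokernel N.arrow) // (cokernel S.arrow).Acyclic },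
      Subobject (x.2.1 : CochainComplex A ℤ))
  have : Fact κ.IsRegular := ⟨hκ'⟩
  have : Nonempty κ.ord.ToType := by simpa using hκ'.ne_zero
  have := WellFoundedLT.toOrderBot κ.ord.ToType
  exact ⟨κ, inferInstance, inferInstance,
    { preservesColimit {A' B X Y} i hi f hf := by
        let hf' : (monomorphisms (CochainComplex A ℤ)).TransfiniteCompositionOfShape
            κ.ord.ToType f :=
          { toTransfiniteCompositionOfShape := hf.toTransfiniteCompositionOfShape
            map_mem j hj := by
              have := (hf.attachCells j hj).pushouts_coproducts
              simp only [ofHoms_homFamily] at this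
              refine (?_ : _ ≤ monomorphisms _) _ this
              simp only [pushouts_le_iff, coproducts_le_iff]
              exact fun _ _ _ h => (generatingTrivialCofibrations_le _ h).1 }
        have (j j' : κ.ord.ToType) (φ : j ⟶ j') : Mono (hf'.F.map φ) := hf'.mem_map φ
        apply IsGrothendieckAbelian.preservesColimit_coyoneda_obj_of_mono (Y := hf'.F) (κ := κ)
        obtain ⟨x⟩ := hi
        exact hκ.of_injective (fun S => ⟨x, S⟩) fun _ _ h =>
          eq_of_heq (Sigma.mk.inj h).2 }⟩

instance : HasFactorization (trivialCofibrationsOfComplexes A) (fibrationsOfComplexes A) := by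
  rw [← llp_rlp_generatingTrivialCofibrations, ← rlp_generatingTrivialCofibrations]
  infer_instance

end Generators

/-! ### The injective derived model structure -/

section InjectiveDerivedModelStructure

variable (A : Type u) [Category.{v} A] [Abelian A] [IsGrothendieckAbelian.{v} A]

/-- The injective derived model structure on the category of complexes. -/
@[reducible]
noncomputable def injectiveDerivedModelStructure : ModelCategory (CochainComplex A ℤ) :=
  letI : CategoryWithFibrations (CochainComplex A ℤ) := ⟨fibrationsOfComplexes A⟩
  letI : CategoryWithCofibrations (CochainComplex A ℤ) := ⟨monomorphisms _⟩
  letI : CategoryWithWeakEquivalences (CochainComplex A ℤ) :=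
    ⟨HomologicalComplex.quasiIso A (ComplexShape.up ℤ)⟩
  have hTC : trivialCofibrations (CochainComplex A ℤ) = trivialCofibrationsOfComplexes A := rfl
  have hTF : trivialFibrations (CochainComplex A ℤ) =
      (monomorphisms (CochainComplex A ℤ)).rlp := rlp_monomorphisms_complexes.symm
  haveI : (weakEquivalences (CochainComplex A ℤ)).HasTwoOutOfThreeProperty :=
    inferInstanceAs (HomologicalComplex.quasiIso A (ComplexShape.up ℤ)).HasTwoOutOfThreeProperty
  haveI : IsWeakFactorizationSystem (cofibrations (CochainComplex A ℤ))
      (trivialFibrations (CochainComplex A ℤ)) := by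
    rw [hTF]
    exact
      { rlp := rfl
        llp := IsGrothendieckAbelian.llp_rlp_monomorphisms (isSeparator_separator _)
        hasFactorization := inferInstanceAs (HasFactorization (monomorphisms _) _) }
  haveI : IsWeakFactorizationSystem (trivialCofibrations (CochainComplex A ℤ))
      (fibrations (CochainComplex A ℤ)) :=
    { rlp := rlp_trivialCofibrationsOfComplexes
      llp := llp_fibrationsOfComplexes
      hasFactorization :=
        inferInstanceAs (HasFactorization (trivialCofibrationsOfComplexes A)
          (fibrationsOfComplexes A)) }
  ModelCategory.mk' _

variable {A}

lemma quasiIso_initial_to_iff (X : CochainComplex A ℤ) :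
    QuasiIso (initial.to X) ↔ X.Acyclic := by
  rw [quasiIso_iff_acyclic_cokernel]
  exact acyclic_iff_of_iso (cokernelIsoOfEq (Subsingleton.elim (initial.to X) 0) ≪≫
    cokernelZeroIsoTarget)

lemma fibrationsOfComplexes_terminal_from_iff (X : CochainComplex A ℤ) :
    fibrationsOfComplexes A (terminal.from X) ↔ homotopyInjectiveComplexesOfInjectives A X := by
  have e : kernel (terminal.from X) ≅ X :=
    kernelIsoOfEq (Subsingleton.elim (terminal.from X) 0) ≪≫ kernelZeroIsoSource
  refine ⟨fun h => (homotopyInjectiveComplexesOfInjectives_iff_of_iso e).1 h.2, fun h =>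
    ⟨⟨fun _ _ _ => ?_⟩, (homotopyInjectiveComplexesOfInjectives_iff_of_iso e).2 h⟩⟩
  exact ((isZero_zero _).of_iso
    (HasZeroObject.zeroIsoTerminal (C := CochainComplex A ℤ)).symm).eq_of_src _ _

variable (A)

lemma injectiveDerivedModelStructure_spec :
    letI := injectiveDerivedModelStructure A
    cofibrantObjects (CochainComplex A ℤ) = ⊤ ∧
      weaklyTrivialObjects (CochainComplex A ℤ) = acyclicComplexes A ∧
      fibrantObjects (CochainComplex A ℤ) = homotopyInjectiveComplexesOfInjectives A := by
  let := injectiveDerivedModelStructure A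
  refine ⟨?_, ?_, ?_⟩
  · exact top_le_iff.1 fun X _ => ⟨(show Mono (initial.to X) from inferInstance)⟩
  · ext X
    exact (weakEquivalence_iff _).trans (quasiIso_initial_to_iff X)
  · ext X
    exact (fibration_iff _).trans (fibrationsOfComplexes_terminal_from_iff X)

lemma injectiveDerivedModelStructure_isCofibrantlyGenerated :
    letI := injectiveDerivedModelStructure A
    IsCofibrantlyGenerated.{v} (CochainComplex A ℤ) := by
  let := injectiveDerivedModelStructure A
  exact
    { trivialFibrations :=
        ⟨IsGrothendieckAbelian.generatingMonomorphisms (separator (CochainComplex A ℤ)),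
          inferInstance, by
            rw [IsGrothendieckAbelian.generatingMonomorphisms_rlp (isSeparator_separator _)]
            exact rlp_monomorphisms_complexes.symm⟩
      fibrations := ⟨generatingTrivialCofibrations A, inferInstance,
        rlp_generatingTrivialCofibrations.symm⟩ }

end InjectiveDerivedModelStructure

/-! ### The hereditary complete cotorsion pair -/

section Splittings

variable {E : Type u} [Category.{v} E] [Abelian E] [HasExt.{w} E]

lemma exists_section_of_extClass_eq_zero {S : ShortComplex E} (hS : S.ShortExact)
    (h : hS.extClass = 0) : ∃ s : S.X₃ ⟶ S.X₂, s ≫ S.g = 𝟙 _ := by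
  obtain ⟨x, hx⟩ := Ext.covariant_sequence_exact₃ S.X₃ hS (Ext.mk₀ (𝟙 S.X₃)) (zero_add 1)
    (by rw [h, Ext.comp_zero])
  obtain ⟨s, rfl⟩ := (Ext.mk₀_bijective _ _).2 x
  exact ⟨s, (Ext.mk₀_bijective _ _).1 (by rwa [Ext.mk₀_comp_mk₀] at hx)⟩

lemma exists_retraction_of_extClass_eq_zero {S : ShortComplex E} (hS : S.ShortExact)
    (h : hS.extClass = 0) : ∃ r : S.X₂ ⟶ S.X₁, S.f ≫ r = 𝟙 _ := by
  obtain ⟨x, hx⟩ := Ext.contravariant_sequence_exact₁ hS S.X₁ (Ext.mk₀ (𝟙 S.X₁)) (add_zero 1)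
    (by rw [h, Ext.zero_comp])
  obtain ⟨r, rfl⟩ := (Ext.mk₀_bijective _ _).2 x
  exact ⟨r, (Ext.mk₀_bijective _ _).1 (by rwa [Ext.mk₀_comp_mk₀] at hx)⟩

end Splittings

section AcyclicComplexes

variable (A : Type u) [Category.{v} A] [Abelian A]

lemma closedUnderKernelsOfEpis_acyclicComplexes :
    ClosedUnderKernelsOfEpis (acyclicComplexes A) := fun _ _ f _ hX hY =>
  (quasiIso_iff_acyclic_kernel f).1 (quasiIso_of_acyclic f hX hY)

lemma closedUnderCokernelsOfMonos_acyclicComplexes :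
    ClosedUnderCokernelsOfMonos (acyclicComplexes A) := fun _ _ f _ hX hY =>
  (quasiIso_iff_acyclic_cokernel f).1 (quasiIso_of_acyclic f hX hY)

end AcyclicComplexes

section CotorsionPair

variable {A : Type u} [Category.{v} A] [Abelian A] [IsGrothendieckAbelian.{v} A]

/-- The map from `K` to the terminal object is a fibration and a quasi-isomorphism, so it lifts
against all monomorphisms. -/
lemma injective_of_acyclic {K : CochainComplex A ℤ}
    (hK : homotopyInjectiveComplexesOfInjectives A K) (hK' : K.Acyclic) : Injective K where
  factors {X Y} g f _ := by
    have hz := (isZero_zero _).of_iso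
      (HasZeroObject.zeroIsoTerminal (C := CochainComplex A ℤ)).symm
    have := hasLiftingProperty_of_mono_of_fibration f (terminal.from K)
      ((fibrationsOfComplexes_terminal_from_iff K).2 hK)
      (Or.inr (quasiIso_of_acyclic _ hK' (HomologicalComplex.acyclic_of_isZero _ hz)))
    have sq : CommSq g f (terminal.from K) (terminal.from Y) := ⟨Subsingleton.elim _ _⟩
    exact ⟨sq.lift, sq.fac_left⟩

/-- The cone of `𝟙 Y` is an injective object with quotient `Y⟦1⟧`. Thus a class in degree one comes
from a map `X ⟶ Y⟦1⟧`, which lifts through the fibration from the cone; a higher class comes from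
one of lower degree with values in `Y⟦1⟧`. -/
lemma ext_acyclic_eq_zero {X : CochainComplex A ℤ} (hX : X.Acyclic) (n : ℕ)
    {Y : CochainComplex A ℤ} (hY : homotopyInjectiveComplexesOfInjectives A Y)
    (e : Ext.{v} X Y (n + 1)) : e = 0 := by
  induction n generalizing Y with
  | zero =>
    have hS := shortExact_cone Y
    have : Injective (mappingCone.triangleRotateShortComplex (𝟙 Y)).X₂ :=
      injective_of_acyclic (homotopyInjectiveComplexesOfInjectives_cone hY.1)
        (acyclic_of_homotopy_zero (coneHomotopyZero Y))
    obtain ⟨x, rfl⟩ := Ext.covariant_sequence_exact₁ X hS e (Ext.eq_zero_of_injective _) rfl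
    obtain ⟨g, rfl⟩ := (Ext.mk₀_bijective _ _).2 x
    have := fibrationsOfComplexes_le_rlp _ (fibrationsOfComplexes_cone hY) (initial.to X)
      ⟨inferInstance, (quasiIso_initial_to_iff X).2 hX⟩
    have sq : CommSq (initial.to _) (initial.to X)
      (mappingCone.triangleRotateShortComplex (𝟙 Y)).g g := ⟨Subsingleton.elim _ _⟩
    rw [← sq.fac_right, ← Ext.mk₀_comp_mk₀, Ext.comp_assoc_of_second_deg_zero, hS.comp_extClass,
      Ext.comp_zero]
    rfl
  | succ n hn =>
    have hS := shortExact_cone Y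
    have : Injective (mappingCone.triangleRotateShortComplex (𝟙 Y)).X₂ :=
      injective_of_acyclic (homotopyInjectiveComplexesOfInjectives_cone hY.1)
        (acyclic_of_homotopy_zero (coneHomotopyZero Y))
    obtain ⟨x, rfl⟩ := Ext.covariant_sequence_exact₁ X hS e (Ext.eq_zero_of_injective _) rfl
    have hx : x = 0 := hn (homotopyInjectiveComplexesOfInjectives_shift hY 1) x
    rw [hx, Ext.zero_comp]
    rfl

lemma admitsSpecialPrecovers_acyclicComplexes :
    AdmitsSpecialPrecovers (acyclicComplexes A) (homotopyInjectiveComplexesOfInjectives A) := by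
  intro X
  let h := factorizationData (trivialCofibrationsOfComplexes A) (fibrationsOfComplexes A)
    (initial.to X)
  have := h.hp.1
  refine ⟨_, _, _, _, kernel.condition h.p, h.hp.2, ?_, shortExact_kernel h.p⟩
  rw [acyclicComplexes, ← quasiIso_initial_to_iff, Subsingleton.elim (initial.to _) h.i]
  exact h.hi.2

lemma exists_trivialCofibration (X : CochainComplex A ℤ) :
    ∃ (R : CochainComplex A ℤ) (i : X ⟶ R), trivialCofibrationsOfComplexes A i ∧
      homotopyInjectiveComplexesOfInjectives A R := by
  let h := factorizationData (trivialCofibrationsOfComplexes A) (fibrationsOfComplexes A)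
    (terminal.from X)
  refine ⟨_, h.i, h.hi, ?_⟩
  rw [← fibrationsOfComplexes_terminal_from_iff, Subsingleton.elim (terminal.from _) h.p]
  exact h.hp

lemma admitsSpecialPreenvelopes_acyclicComplexes :
    AdmitsSpecialPreenvelopes (acyclicComplexes A) (homotopyInjectiveComplexesOfInjectives A) := by
  intro X
  obtain ⟨R, i, hi, hR⟩ := exists_trivialCofibration X
  have := hi.1
  exact ⟨_, _, _, _, cokernel.condition i, hR, (quasiIso_iff_acyclic_cokernel i).1 hi.2,
    shortExact_cokernel i⟩

variable (A)

/-- An object orthogonal to one class has a split approximation sequence, hence is a retract of a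
member of the other class. -/
lemma isCompleteCotorsionPair_acyclicComplexes :
    IsCompleteCotorsionPair.{v} (acyclicComplexes A)
      (homotopyInjectiveComplexesOfInjectives A) where
  right_eq := by
    refine le_antisymm (fun Y hY X hX e => ext_acyclic_eq_zero hX 0 hY e) fun Y hY => ?_
    obtain ⟨R, L, i, p, zero, hR, hL, hS⟩ := admitsSpecialPreenvelopes_acyclicComplexes Y
    obtain ⟨r, hr⟩ := exists_retraction_of_extClass_eq_zero hS (hY hL _)
    exact homotopyInjectiveComplexesOfInjectives_of_retract i r hr hR
  left_eq := by
    refine le_antisymm (fun X hX Y hY e => ext_acyclic_eq_zero hX 0 hY e) fun X hX => ?_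
    obtain ⟨R, L, i, p, zero, hR, hL, hS⟩ := admitsSpecialPrecovers_acyclicComplexes X
    obtain ⟨s, hs⟩ := exists_section_of_extClass_eq_zero hS (hX hR _)
    exact acyclic_of_retract s p hs hL
  precovers := admitsSpecialPrecovers_acyclicComplexes
  preenvelopes := admitsSpecialPreenvelopes_acyclicComplexes

/-- Since the right class is an Ext-orthogonal, it suffices that `Ext¹(L, cokernel f)` lies between
`Ext¹(L, Y)` and `Ext²(L, X)`, both zero. -/
lemma closedUnderCokernelsOfMonos_homotopyInjectiveComplexesOfInjectives :
    ClosedUnderCokernelsOfMonos (homotopyInjectiveComplexesOfInjectives A) := by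
  intro X Y f _ hX hY
  rw [(isCompleteCotorsionPair_acyclicComplexes A).right_eq]
  intro L hL e
  obtain ⟨x, rfl⟩ := Ext.covariant_sequence_exact₃ L (shortExact_cokernel f) e rfl
    (ext_acyclic_eq_zero hL 1 hX _)
  rw [ext_acyclic_eq_zero hL 0 hY x, Ext.zero_comp]

lemma isHereditaryCompleteCotorsionPair_acyclicComplexes :
    IsHereditaryCompleteCotorsionPair.{v} (acyclicComplexes A)
      (homotopyInjectiveComplexesOfInjectives A) where
  toIsCompleteCotorsionPair := isCompleteCotorsionPair_acyclicComplexes A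
  left_kernels := closedUnderKernelsOfEpis_acyclicComplexes A
  right_cokernels := closedUnderCokernelsOfMonos_homotopyInjectiveComplexesOfInjectives A
  ext_eq_zero X Y hX hY n hn e := by
    obtain ⟨n, rfl⟩ := Nat.exists_eq_add_of_le' hn
    exact ext_acyclic_eq_zero hX n hY e

lemma injectiveDerivedModelStructure_isHereditaryAbelian :
    letI := injectiveDerivedModelStructure A
    IsHereditaryAbelianModelStructure (CochainComplex A ℤ) := by
  let := injectiveDerivedModelStructure A
  obtain ⟨hc, hw, hf⟩ := injectiveDerivedModelStructure_spec A
  exact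
    { cofibrations_eq := by
        rw [hc]
        ext X Y f
        exact ⟨fun h => ⟨h, trivial⟩, fun h => h.1⟩
      fibrations_eq := by
        rw [hf]
        rfl
      cofibrant_kernels := by
        rw [hc]
        exact fun _ _ _ _ _ _ => trivial
      triviallyCofibrant_kernels := by
        rw [hc, hw, top_inf_eq]
        exact closedUnderKernelsOfEpis_acyclicComplexes A
      fibrant_cokernels := by
        rw [hf]
        exact closedUnderCokernelsOfMonos_homotopyInjectiveComplexesOfInjectives A
      triviallyFibrant_cokernels := by
        rw [hf, hw]
        exact fun _ _ f _ hX hY =>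
          ⟨closedUnderCokernelsOfMonos_homotopyInjectiveComplexesOfInjectives A f hX.1 hY.1,
            closedUnderCokernelsOfMonos_acyclicComplexes A f hX.2 hY.2⟩ }

end CotorsionPair

open Pretriangulated

/-! ### Homotopy injective complexes and the derived category -/

section EnoughHomotopyInjectives

variable (A : Type u) [Category.{v} A] [Abelian A]

/-- The complexes of injective objects, as objects of the homotopy category. -/
def termwiseInjective : ObjectProperty (HomotopyCategory A (ComplexShape.up ℤ)) :=
  fun J => ∀ n : ℤ, Injective (J.as.X n)

instance : (termwiseInjective A).ContainsZero where
  exists_zero := ⟨(HomotopyCategory.quotient A (ComplexShape.up ℤ)).obj 0,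
    (HomotopyCategory.quotient A (ComplexShape.up ℤ)).map_isZero (isZero_zero _), fun n =>
      (show IsZero ((0 : CochainComplex A ℤ).X n) from
        (HomologicalComplex.eval A _ n).map_isZero (isZero_zero _)).injective⟩

instance : (termwiseInjective A).IsStableUnderShift ℤ where
  isStableUnderShiftBy n := ⟨fun J hJ => by
    have h : J⟦n⟧ = (HomotopyCategory.quotient A (ComplexShape.up ℤ)).obj
      ((show CochainComplex A ℤ from J.as)⟦n⟧) := HomotopyCategory.shift_quotient_obj J.as n
    change termwiseInjective A (J⟦n⟧)
    rw [h]
    exact fun i => hJ (i + n)⟩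

/-- Termwise injectivity is not invariant under homotopy equivalence, so closure holds up to
isomorphism: the third vertex is isomorphic to a mapping cone, which has injective terms. -/
instance : (termwiseInjective A).IsTriangulatedClosed₃ where
  ext₃' T hT h₁ h₂ := by
    obtain ⟨f, hf⟩ := (HomotopyCategory.quotient A (ComplexShape.up ℤ)).map_surjective
      (X := T.obj₁.as) (Y := T.obj₂.as) T.mor₁
    have e := isoTriangleOfIso₁₂ _ _ hT
      (HomotopyCategory.mappingCone_triangleh_distinguished f) (Iso.refl _) (Iso.refl _)
      (by
        refine (Category.comp_id _).trans (Eq.trans hf.symm (Category.id_comp _).symm))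
    exact ⟨_, injective_cone_X f h₁ h₂, ⟨Triangle.π₃.mapIso e⟩⟩

instance : (termwiseInjective A).IsTriangulatedClosed₂ :=
  ObjectProperty.IsTriangulatedClosed₂.of_isTriangulatedClosed₃

instance : (termwiseInjective A).IsTriangulated where

instance : (homotopyInjectiveOfInjectives A).IsTriangulated :=
  inferInstanceAs (termwiseInjective A ⊓
    (HomotopyCategory.subcategoryAcyclic A).rightOrthogonal).IsTriangulated

variable [HasDerivedCategory.{w} A]

/-- Localization at the acyclic complexes is bijective on maps into an object right orthogonal to
them. -/
lemma homotopyInjectiveToDerived_map_bijective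
    (K L : (homotopyInjectiveOfInjectives A).FullSubcategory) :
    Function.Bijective ((homotopyInjectiveToDerived A).map : (K ⟶ L) → _) :=
  (L.2.2.map_bijective_of_isTriangulated DerivedCategory.Qh K.1).comp
    ((homotopyInjectiveOfInjectives A).fullyFaithfulι.map_bijective K L)

instance : (homotopyInjectiveToDerived A).Full where
  map_surjective := (homotopyInjectiveToDerived_map_bijective A _ _).2

instance : (homotopyInjectiveToDerived A).Faithful where
  map_injective h := (homotopyInjectiveToDerived_map_bijective A _ _).1 h

instance [IsGrothendieckAbelian.{v} A] : (homotopyInjectiveToDerived A).EssSurj where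
  mem_essImage Y := by
    let K := DerivedCategory.Q.objPreimage Y
    obtain ⟨R, i, hi, hR⟩ := exists_trivialCofibration K
    have := hi.2
    refine ⟨⟨(HomotopyCategory.quotient A (ComplexShape.up ℤ)).obj R, hR.1, ?_⟩, ⟨?_⟩⟩
    · have := hR.2
      exact CochainComplex.IsKInjective.rightOrthogonal R
    · exact (DerivedCategory.quotientCompQhIso A).app R ≪≫
        (asIso (DerivedCategory.Q.map i)).symm ≪≫ DerivedCategory.Q.objObjPreimageIso Y

lemma hasEnoughHomotopyInjectivesOfInjectives [IsGrothendieckAbelian.{v} A] :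
    HasEnoughHomotopyInjectivesOfInjectives A :=
  ⟨inferInstance, inferInstance, { }⟩

end EnoughHomotopyInjectives

end AbelianModel

theorem mainTheorem8 (A : Type u) [Category.{v} A] [Abelian A] [IsGrothendieckAbelian.{v} A]
    [HasDerivedCategory.{w} A] :
    AbelianModel.IsHereditaryCompleteCotorsionPair.{v}
        (AbelianModel.acyclicComplexes A)
        (AbelianModel.homotopyInjectiveComplexesOfInjectives A) ∧
      (∃ _ : ModelCategory (CochainComplex A ℤ),
        AbelianModel.cofibrantObjects (CochainComplex A ℤ) = ⊤ ∧
        AbelianModel.weaklyTrivialObjects (CochainComplex A ℤ) =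
          AbelianModel.acyclicComplexes A ∧
        AbelianModel.fibrantObjects (CochainComplex A ℤ) =
          AbelianModel.homotopyInjectiveComplexesOfInjectives A ∧
        AbelianModel.IsHereditaryAbelianModelStructure (CochainComplex A ℤ) ∧
        AbelianModel.IsCofibrantlyGenerated.{v} (CochainComplex A ℤ)) ∧
      AbelianModel.HasEnoughHomotopyInjectivesOfInjectives A := by
  obtain ⟨hc, hw, hf⟩ := AbelianModel.injectiveDerivedModelStructure_spec A
  exact ⟨AbelianModel.isHereditaryCompleteCotorsionPair_acyclicComplexes A,
    ⟨AbelianModel.injectiveDerivedModelStructure A, hc, hw, hf,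
      AbelianModel.injectiveDerivedModelStructure_isHereditaryAbelian A,
      AbelianModel.injectiveDerivedModelStructure_isCofibrantlyGenerated A⟩,
    AbelianModel.hasEnoughHomotopyInjectivesOfInjectives A⟩
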